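/- Let $d\ge 0$ and let $\mathbb D$ be $\mathbb R^d$ (Euclidean norm) or the flat torus $\mathbb T^d=\mathbb R^d/\mathbb Z^d$ (with $|x|$ the flat distance to $0$). A state-weight triplet $(X,w,(\Omega,\mathcal A,\pi))$ consists of a standard probability space $(\Omega,\mathcal A,\pi)$, a measurable map $X:\Omega\to\mathbb D$ and a measurable function $w:\Omega\times\Omega\to\mathbb R$. The cut norm of an integrable kernel $w$ is $\|w\|_\square=\sup_{S,T}\big|\int_{S\times T}w\,\mathrm d(\pi\otimes\pi)\big|$, over measurable $S,T\subseteq\Omega$. The unlabeled $W_1$-cut distance of two triplets is $$\delta_{W_1,\square}\big((X^{(1)},w^{(1)},\Omega^{(1)}),(X^{(2)},w^{(2)},\Omega^{(2)})\big)=\inf_{\varphi_1,\varphi_2}\Big(\|X^{(1)}\circ\varphi_1-X^{(2)}\circ\varphi_2\|_{L^1}+\|w^{(1)}\circ(\varphi_1\times\varphi_1)-w^{(2)}\circ(\varphi_2\times\varphi_2)\|_\square\Big),$$ where the infimum is over all measure-preserving maps $\varphi_k:\Omega'\to\Omega^{(k)}$ ($k=1,2$) from a common standard probability space $\Omega'$.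 **Sampling lemma.** For all real $A,B$ there is a constant $C>0$, depending only on $A$, $B$ and the fixed state space $\mathbb D$, such that the following holds. Let $(X,w,(\Omega,\mathcal A,\pi))$ be a state-weight triplet with $\int_\Omega|X|^2\,\mathrm d\pi\le A$, with $|w|\le B$ $\pi\otimes\pi$-almost everywhere, and with $|w(\xi,\xi)|\le B$ for $\pi$-almost every $\xi$. Let $N\ge 2$, and let $\pi_1,\dots,\pi_N$ be probability measures on $\Omega$, absolutely continuous with respect to $\pi$, with $\frac1N\sum_{i=1}^N\pi_i=\pi$. Let $(\xi_1,\dots,\xi_N)$ have law $\bigotimes_{i=1}^N\pi_i$, and consider the sampled triplet with states $X_{\xi_i}$ and weights $w_{\xi_i,\xi_j}$ ($1\le i,j\le N$, diagonal included) on the label space $[N]=\{1,\dots,N\}$ with the uniform probability measure. Then its distance to $(X,w,\Omega)$ is a random variable (measurable for the completed product $\sigma$-algebra), and $$\mathbb E\Big[\delta_{W_1,\square}\Big(\big((X_{\xi_i})_{i\in[N]},(w_{\xi_i,\xi_j})_{i,j\in[N]},[N]\big),(X,w,\Omega)\Big)\Big]\le\frac{C}{\sqrt{\log N}}.$$ 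-/

import Mathlib

open MeasureTheory
open scoped ENNReal

universe u

/-- The flat torus `ℝ^d / ℤ^d` with its Euclidean quotient norm: `‖x - y‖` is the flat distance. -/
abbrev FlatTorus (d : ℕ) : Type := PiLp 2 (fun _ : Fin d => UnitAddCircle)

/-- The cut norm `sup_{S, T ⊆ Ω} |∫_{S × T} w d(π ⊗ π)|`, with `S`, `T` measurable, of a kernel `w`
that is integrable for `π ⊗ π`. -/
noncomputable def cutNorm {Ω : Type*} [MeasurableSpace Ω] (π : Measure Ω) (w : Ω → Ω → ℝ) :
    ℝ≥0∞ :=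
  ⨆ (S : Set Ω) (T : Set Ω) (_ : MeasurableSet S) (_ : MeasurableSet T),
    ENNReal.ofReal |∫ p in S ×ˢ T, w p.1 p.2 ∂(π.prod π)|

/-- The unlabeled `W₁`-cut distance between the state-weight triplets `(X₁, w₁, (Ω₁, π₁))` and
`(X₂, w₂, (Ω₂, π₂))`: the infimum, over all standard probability spaces `(Ω, μ)` and all
measure-preserving maps `φ₁ : Ω → Ω₁`, `φ₂ : Ω → Ω₂`, of the `L¹` distance of the relabeled states
plus the cut norm of the difference of the relabeled weights. -/
noncomputable def unlabeledDist.{r, s, t} {D : Type t} [NormedAddCommGroup D]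
    {Ω₁ : Type r} [MeasurableSpace Ω₁] {Ω₂ : Type s} [MeasurableSpace Ω₂]
    (X₁ : Ω₁ → D) (w₁ : Ω₁ → Ω₁ → ℝ) (π₁ : Measure Ω₁)
    (X₂ : Ω₂ → D) (w₂ : Ω₂ → Ω₂ → ℝ) (π₂ : Measure Ω₂) : ℝ≥0∞ :=
  ⨅ (Ω : Type (max r s)) (_ : MeasurableSpace Ω) (_ : StandardBorelSpace Ω)
    (μ : Measure Ω) (_ : IsProbabilityMeasure μ)
    (φ₁ : Ω → Ω₁) (φ₂ : Ω → Ω₂)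
    (_ : MeasurePreserving φ₁ μ π₁) (_ : MeasurePreserving φ₂ μ π₂),
    eLpNorm (fun ξ => X₁ (φ₁ ξ) - X₂ (φ₂ ξ)) 1 μ +
      cutNorm μ (fun ξ ζ => w₁ (φ₁ ξ) (φ₁ ζ) - w₂ (φ₂ ξ) (φ₂ ζ))

/-- The uniform probability measure on the label set `[N]`. -/
noncomputable def uniformLabel (N : ℕ) : Measure (Fin N) :=
  (N : ℝ≥0∞)⁻¹ • Measure.count

/-- The probability measures `π₁, …, π_N` on `Ω` induce an independent mixture space
`(Ω^N, ⨂ πᵢ)` over `(Ω, π)`: they are absolutely continuous with respect to `π` and average to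
`π`. -/
structure IsIndependentMixture {Ω : Type*} [MeasurableSpace Ω] (π : Measure Ω) {N : ℕ}
    (πs : Fin N → Measure Ω) : Prop where
  isProbabilityMeasure : ∀ i, IsProbabilityMeasure (πs i)
  absolutelyContinuous : ∀ i, πs i ≪ π
  average : (N : ℝ≥0∞)⁻¹ • ∑ i, πs i = π

/-- The unlabeled distance between `(X, w, (Ω, π))` and its `N`-sampling by the labels
`ξ = (ξ₁, …, ξ_N)`, i.e. the triplet with states `X(ξᵢ)`, weights `w(ξᵢ, ξⱼ)` (diagonal included)
and label space `[N]`. -/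
noncomputable def samplingDist {D Ω : Type*} [NormedAddCommGroup D] [MeasurableSpace Ω]
    (X : Ω → D) (w : Ω → Ω → ℝ) (π : Measure Ω) {N : ℕ} (ξ : Fin N → Ω) : ℝ≥0∞ :=
  unlabeledDist (fun i => X (ξ i)) (fun i j => w (ξ i) (ξ j)) (uniformLabel N) X w π

/-! The kernel is split into a structured part that sees only a few classes of labels and a
remainder that is small in cut norm; the two parts are sampled for different reasons. After an `L¹`
approximation (`exists_finite_kernel_approx`) the kernel is a bounded matrix `W` on finitely many
classes. Weak regularity (`exists_sign_rectangles`) gives `u = ε ∑ s_l ⊗ t_l` with at most `k₀`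
terms and `ε = B / √k₀`, such that `W - u` has sign norm at most `ε` and `L²` norm at most `B`.

The remainder `W - u` stays small after sampling (`prodExp_signNorm_sample_le`): its sampled sign
norm is at most `4ε + 16 B / √N` plus a diagonal term, however many classes `W` has. Decoupling
makes rows and columns independent samples. Symmetrization and contraction reduce each of the two
samplings to a Rademacher average, which is linear in the competing signs; the supremum therefore
becomes a sum of absolute values, and Khinchine bounds each of them without any entropy cost.

The structured part `u` and the state function, rounded to a grid of mesh `1 / n` in `[-n, n]^d`,
depend only on a class: a grid cell and two sign patterns. With `K` classes, the empirical class
frequencies deviate from their means by at most `2 √(K / N)` in total, in expectation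
(`prodExp_sum_abs_count_sub_le`), and `exists_coupling` pairs labels with points so that their
classes disagree with probability at most this deviation. Such a coupling is the common space `Ω'`
in the distance (`samplingDist_le`).

Since `K ≤ (2n² + 1)^d 4^k₀`, the choices `k₀ ≈ (log N) / 8` and `n ≈ √(log N)` make the coupling
error a negative power of `N` up to logarithms. What remains is the regularity error `B / √k₀` and
the rounding error `(d + A) / n`, both of order `1 / √(log N)`. Only independence and the average of
the `πᵢ` enter, so identical laws are not needed. On the torus, states are lifted to `[0, 1)^d`, and
the projection back is `1`-Lipschitz. Measurability follows because the distance is Lipschitz in the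
sampled states and weights. -/

/-- The sign `±1` as a real number. -/
def sgn (s : ℤˣ) : ℝ := ((s : ℤ) : ℝ)

lemma sgn_mul_self (s : ℤˣ) : sgn s * sgn s = 1 := by
  rcases Int.units_eq_one_or s with rfl | rfl <;> simp [sgn]

lemma abs_sgn (s : ℤˣ) : |sgn s| = 1 := by
  rcases Int.units_eq_one_or s with rfl | rfl <;> simp [sgn]

lemma sgn_neg (s : ℤˣ) : sgn (-s) = -sgn s := by simp [sgn]

lemma sgn_eq_one_or (s : ℤˣ) : sgn s = 1 ∨ sgn s = -1 := by
  rcases Int.units_eq_one_or s with rfl | rfl <;> simp [sgn]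

lemma exists_sgn_mul_eq_abs (x : ℝ) : ∃ s : ℤˣ, sgn s * x = |x| := by
  rcases le_total 0 x with h | h
  · exact ⟨1, by simp [sgn, abs_of_nonneg h]⟩
  · exact ⟨-1, by simp [sgn, abs_of_nonpos h]⟩

lemma sgn_mul_le_abs (s : ℤˣ) (x : ℝ) : sgn s * x ≤ |x| := by
  calc sgn s * x ≤ |sgn s * x| := le_abs_self _
    _ = |x| := by rw [abs_mul, abs_sgn, one_mul]

lemma mul_le_abs_of_abs_le_one {s : ℝ} (hs : |s| ≤ 1) (x : ℝ) : s * x ≤ |x| := by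
  calc s * x ≤ |s * x| := le_abs_self _
    _ = |s| * |x| := abs_mul _ _
    _ ≤ 1 * |x| := by gcongr
    _ = |x| := one_mul _

lemma le_ciSup_of_finite {κ : Type*} [Finite κ] (f : κ → ℝ) (k : κ) : f k ≤ ⨆ k, f k :=
  le_ciSup (Set.finite_range f).bddAbove k

/-! ### The `∞ → 1` norm of a finite matrix. -/

section SignNorm

variable {α β : Type*} [Fintype α] [Fintype β]

/-- The `∞ → 1` norm of a finite matrix: the maximum of `∑ s_a t_b V_ab` over signs. -/
noncomputable def signNorm (V : α → β → ℝ) : ℝ :=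
  ⨆ st : (α → ℤˣ) × (β → ℤˣ), ∑ a, ∑ b, sgn (st.1 a) * sgn (st.2 b) * V a b

lemma sum_sgn_le_signNorm (V : α → β → ℝ) (s : α → ℤˣ) (t : β → ℤˣ) :
    ∑ a, ∑ b, sgn (s a) * sgn (t b) * V a b ≤ signNorm V :=
  le_ciSup_of_finite (fun st : (α → ℤˣ) × (β → ℤˣ) =>
    ∑ a, ∑ b, sgn (st.1 a) * sgn (st.2 b) * V a b) (s, t)

lemma signNorm_le {V : α → β → ℝ} {c : ℝ}
    (h : ∀ (s : α → ℤˣ) (t : β → ℤˣ), ∑ a, ∑ b, sgn (s a) * sgn (t b) * V a b ≤ c) :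
    signNorm V ≤ c :=
  ciSup_le fun st => h st.1 st.2

/-- Once the row signs are fixed, the best column signs are those of the signed column sums. -/
lemma sum_abs_col_le_signNorm (V : α → β → ℝ) (s : α → ℤˣ) :
    ∑ b, |∑ a, sgn (s a) * V a b| ≤ signNorm V := by
  choose t ht using fun b => exists_sgn_mul_eq_abs (∑ a, sgn (s a) * V a b)
  calc ∑ b, |∑ a, sgn (s a) * V a b| = ∑ a, ∑ b, sgn (s a) * sgn (t b) * V a b := by
        rw [Finset.sum_comm]
        refine Finset.sum_congr rfl fun b _ => ?_
        rw [← ht b, Finset.mul_sum]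
        exact Finset.sum_congr rfl fun a _ => by ring
    _ ≤ _ := sum_sgn_le_signNorm V s t

lemma sum_abs_row_le_signNorm (V : α → β → ℝ) (t : β → ℤˣ) :
    ∑ a, |∑ b, sgn (t b) * V a b| ≤ signNorm V := by
  choose s hs using fun a => exists_sgn_mul_eq_abs (∑ b, sgn (t b) * V a b)
  calc ∑ a, |∑ b, sgn (t b) * V a b| = ∑ a, ∑ b, sgn (s a) * sgn (t b) * V a b := by
        refine Finset.sum_congr rfl fun a _ => ?_
        rw [← hs a, Finset.mul_sum]
        exact Finset.sum_congr rfl fun b _ => by ring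
    _ ≤ _ := sum_sgn_le_signNorm V s t

lemma sum_sgn_le_sum_abs_col (V : α → β → ℝ) (s : α → ℤˣ) (t : β → ℤˣ) :
    ∑ a, ∑ b, sgn (s a) * sgn (t b) * V a b ≤ ∑ b, |∑ a, sgn (s a) * V a b| := by
  rw [Finset.sum_comm]
  refine Finset.sum_le_sum fun b _ => ?_
  calc ∑ a, sgn (s a) * sgn (t b) * V a b = sgn (t b) * ∑ a, sgn (s a) * V a b := by
        rw [Finset.mul_sum]; exact Finset.sum_congr rfl fun a _ => by ring
    _ ≤ _ := sgn_mul_le_abs _ _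

/-- A bilinear form on a product of cubes is maximal at vertices: `σ` and then `τ` can be rounded to
signs without loss. This lets indicators and fractions in `[0, 1]` be tested against the sign norm.
-/
lemma sum_mul_le_signNorm (V : α → β → ℝ) {σ : α → ℝ} {τ : β → ℝ} (hσ : ∀ a, |σ a| ≤ 1)
    (hτ : ∀ b, |τ b| ≤ 1) : ∑ a, ∑ b, σ a * τ b * V a b ≤ signNorm V := by
  choose s hs using fun a => exists_sgn_mul_eq_abs (∑ b, τ b * V a b)
  calc ∑ a, ∑ b, σ a * τ b * V a b = ∑ a, σ a * ∑ b, τ b * V a b := by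
        refine Finset.sum_congr rfl fun a _ => ?_
        rw [Finset.mul_sum]; exact Finset.sum_congr rfl fun b _ => by ring
    _ ≤ ∑ a, |∑ b, τ b * V a b| :=
        Finset.sum_le_sum fun a _ => mul_le_abs_of_abs_le_one (hσ a) _
    _ = ∑ b, τ b * ∑ a, sgn (s a) * V a b := by
        simp_rw [← hs, Finset.mul_sum]
        rw [Finset.sum_comm]
        exact Finset.sum_congr rfl fun b _ => Finset.sum_congr rfl fun a _ => by ring
    _ ≤ ∑ b, |∑ a, sgn (s a) * V a b| :=
        Finset.sum_le_sum fun b _ => mul_le_abs_of_abs_le_one (hτ b) _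
    _ ≤ _ := sum_abs_col_le_signNorm V s

lemma abs_sum_mul_le_signNorm (V : α → β → ℝ) {σ : α → ℝ} {τ : β → ℝ} (hσ : ∀ a, |σ a| ≤ 1)
    (hτ : ∀ b, |τ b| ≤ 1) : |∑ a, ∑ b, σ a * τ b * V a b| ≤ signNorm V := by
  rw [abs_le']
  refine ⟨sum_mul_le_signNorm V hσ hτ, ?_⟩
  have := sum_mul_le_signNorm V (σ := fun a => - σ a) (by simpa using hσ) hτ
  simpa [Finset.sum_neg_distrib] using this

lemma signNorm_nonneg (V : α → β → ℝ) : 0 ≤ signNorm V := by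
  simpa using sum_mul_le_signNorm V (σ := fun _ => 0) (τ := fun _ => 0) (by simp) (by simp)

lemma signNorm_add_le (V W : α → β → ℝ) :
    signNorm (fun a b => V a b + W a b) ≤ signNorm V + signNorm W := by
  refine signNorm_le fun s t => ?_
  simp_rw [mul_add, Finset.sum_add_distrib]
  exact add_le_add (sum_sgn_le_signNorm V s t) (sum_sgn_le_signNorm W s t)

lemma signNorm_le_sum_abs (V : α → β → ℝ) : signNorm V ≤ ∑ a, ∑ b, |V a b| := by
  refine signNorm_le fun s t => Finset.sum_le_sum fun a _ => Finset.sum_le_sum fun b _ => ?_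
  refine mul_le_abs_of_abs_le_one ?_ _
  rw [abs_mul, abs_sgn, abs_sgn, one_mul]

lemma signNorm_const_mul {c : ℝ} (hc : 0 ≤ c) (V : α → β → ℝ) :
    signNorm (fun a b => c * V a b) = c * signNorm V := by
  unfold signNorm
  rw [Real.mul_iSup_of_nonneg hc]
  congr 1; ext st
  simp_rw [Finset.mul_sum]
  exact Finset.sum_congr rfl fun a _ => Finset.sum_congr rfl fun b _ => by ring

end SignNorm

/-! ### Finite product expectations, Rademacher averages and symmetrization. -/

section ProdExp

variable {ι α : Type*} [Fintype ι] [Fintype α] [DecidableEq ι]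

/-- The expectation of `F` under the product of the probability vectors `p i`. -/
noncomputable def prodExp (p : ι → α → ℝ) (F : (ι → α) → ℝ) : ℝ :=
  ∑ a : ι → α, (∏ i, p i (a i)) * F a

variable {p : ι → α → ℝ}

lemma prodExp_mono (hp : ∀ i a, 0 ≤ p i a) {F G : (ι → α) → ℝ} (h : ∀ a, F a ≤ G a) :
    prodExp p F ≤ prodExp p G :=
  Finset.sum_le_sum fun a _ =>
    mul_le_mul_of_nonneg_left (h a) (Finset.prod_nonneg fun i _ => hp i (a i))

lemma prodExp_add (F G : (ι → α) → ℝ) :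
    prodExp p (fun a => F a + G a) = prodExp p F + prodExp p G := by
  simp [prodExp, mul_add, Finset.sum_add_distrib]

lemma prodExp_const_mul (c : ℝ) (F : (ι → α) → ℝ) :
    prodExp p (fun a => c * F a) = c * prodExp p F := by
  simp only [prodExp, Finset.mul_sum]
  exact Finset.sum_congr rfl fun a _ => by ring

lemma prodExp_sum {κ : Type*} (s : Finset κ) (F : κ → (ι → α) → ℝ) :
    prodExp p (fun a => ∑ k ∈ s, F k a) = ∑ k ∈ s, prodExp p (F k) := by
  simp only [prodExp, Finset.mul_sum]
  exact Finset.sum_comm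

lemma sum_prod_eq_one (h1 : ∀ i, ∑ a, p i a = 1) : ∑ a : ι → α, ∏ i, p i (a i) = 1 := by
  have := Finset.prod_univ_sum (fun _ : ι => (Finset.univ : Finset α)) (fun i a => p i a)
  rw [Fintype.piFinset_univ] at this
  rw [← this]; simp [h1]

lemma prodExp_const (h1 : ∀ i, ∑ a, p i a = 1) (c : ℝ) : prodExp p (fun _ => c) = c := by
  rw [prodExp, ← Finset.sum_mul, sum_prod_eq_one h1, one_mul]

lemma prodExp_eval (h1 : ∀ i, ∑ a, p i a = 1) (i : ι) (h : α → ℝ) :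
    prodExp p (fun a => h (a i)) = ∑ c, p i c * h c := by
  have := Finset.prod_univ_sum (fun _ : ι => (Finset.univ : Finset α))
    (fun j a => p j a * if j = i then h a else 1)
  rw [Fintype.piFinset_univ, Finset.prod_eq_single i] at this
  · simp only [if_true] at this
    rw [this, prodExp]
    refine Finset.sum_congr rfl fun a _ => ?_
    rw [Finset.prod_mul_distrib, Finset.prod_ite_eq' Finset.univ i]
    simp
  · intro j _ hj; simp [hj, h1]
  · simp

lemma prodExp_comm {κ γ : Type*} [Fintype κ] [Fintype γ] [DecidableEq κ] (p' : κ → γ → ℝ)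
    (F : (ι → α) → (κ → γ) → ℝ) :
    prodExp p (fun a => prodExp p' (fun b => F a b)) =
      prodExp p' (fun b => prodExp p (fun a => F a b)) := by
  simp only [prodExp, Finset.mul_sum]
  rw [Finset.sum_comm]
  exact Finset.sum_congr rfl fun b _ => Finset.sum_congr rfl fun a _ => by ring

/-- Jensen's inequality for the square root, obtained from Cauchy–Schwarz because the weights have
mass one. -/
lemma prodExp_sqrt_le (hp : ∀ i a, 0 ≤ p i a) (h1 : ∀ i, ∑ a, p i a = 1) {F : (ι → α) → ℝ}
    (hF : ∀ a, 0 ≤ F a) : prodExp p (fun a => √(F a)) ≤ √(prodExp p F) := by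
  have hw : ∀ a : ι → α, 0 ≤ ∏ i, p i (a i) := fun a => Finset.prod_nonneg fun i _ => hp i (a i)
  have := Real.sum_sqrt_mul_sqrt_le Finset.univ (f := fun a : ι → α => ∏ i, p i (a i))
    (g := fun a => (∏ i, p i (a i)) * F a) hw (fun a => mul_nonneg (hw a) (hF a))
  rw [sum_prod_eq_one h1, Real.sqrt_one, one_mul] at this
  refine le_trans (le_of_eq ?_) this
  refine Finset.sum_congr rfl fun a _ => ?_
  rw [Real.sqrt_mul (hw a), ← mul_assoc, Real.mul_self_sqrt (hw a)]

/-- Two independent copies have the same law `p i` in coordinate `i`, so exchanging them in the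
coordinates outside `I` preserves the joint law. Symmetrization and decoupling both rest on this
exchange. -/
lemma prodExp_swap (I : Finset ι) (F : (ι → α) → (ι → α) → ℝ) :
    prodExp p (fun a => prodExp p (fun b => F a b)) =
      prodExp p (fun a => prodExp p (fun b => F (I.piecewise a b) (I.piecewise b a))) := by
  simp only [prodExp, Finset.mul_sum, ← mul_assoc, ← Finset.prod_mul_distrib]
  have hinv : Function.Involutive (fun ab : (ι → α) × (ι → α) =>
      (I.piecewise ab.1 ab.2, I.piecewise ab.2 ab.1)) := by
    rintro ⟨a, b⟩
    ext i <;> by_cases h : i ∈ I <;> simp [Finset.piecewise, h]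
  rw [← Fintype.sum_prod_type' (f := fun a b => (∏ i, p i (a i) * p i (b i)) * F a b),
    ← Fintype.sum_prod_type' (f := fun a b => (∏ i, p i (a i) * p i (b i)) *
      F (I.piecewise a b) (I.piecewise b a)), ← Equiv.sum_comp hinv.toPerm]
  refine Finset.sum_congr rfl fun ab _ => ?_
  simp only [Function.Involutive.coe_toPerm]
  congr 1
  refine Finset.prod_congr rfl fun i _ => ?_
  by_cases h : i ∈ I <;> simp [Finset.piecewise, h, mul_comm]

/-- Expectation over independent uniform signs. -/
noncomputable def radExp (F : (ι → ℤˣ) → ℝ) : ℝ := prodExp (fun _ _ => (1 / 2 : ℝ)) F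

lemma half_nonneg_vec {ι : Type*} : ∀ (_ : ι) (_ : ℤˣ), (0 : ℝ) ≤ 1 / 2 := fun _ _ => by norm_num

lemma half_sum_vec {ι : Type*} : ∀ _ : ι, ∑ _r : ℤˣ, (1 / 2 : ℝ) = 1 := fun _ => by simp

lemma radExp_comp_equiv (e : Equiv.Perm (ι → ℤˣ)) (F : (ι → ℤˣ) → ℝ) :
    radExp (fun r => F (e r)) = radExp F := by
  simp only [radExp, prodExp, Finset.prod_const]
  exact Equiv.sum_comp e (fun r => (1 / 2 : ℝ) ^ (Finset.univ : Finset ι).card * F r)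

lemma radExp_neg (F : (ι → ℤˣ) → ℝ) : radExp (fun r => F (fun i => -r i)) = radExp F :=
  radExp_comp_equiv (Equiv.neg (ι → ℤˣ)) F

/-- Flip the sign at `i`. -/
def flipAt {ι : Type*} [DecidableEq ι] (i : ι) (r : ι → ℤˣ) : ι → ℤˣ := Function.update r i (-r i)

lemma flipAt_involutive {ι : Type*} [DecidableEq ι] (i : ι) : Function.Involutive (flipAt i) := by
  intro r; simp [flipAt]

lemma radExp_flip (i : ι) (F : (ι → ℤˣ) → ℝ) : radExp (fun r => F (flipAt i r)) = radExp F :=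
  radExp_comp_equiv (flipAt_involutive i).toPerm F

/-- For `i ≠ j`, flipping the sign at `i` preserves the uniform law and negates the product. -/
lemma radExp_mul_sgn (i j : ι) :
    radExp (fun r : ι → ℤˣ => sgn (r i) * sgn (r j)) = if i = j then 1 else 0 := by
  split_ifs with h
  · subst h; simp only [sgn_mul_self]
    exact prodExp_const half_sum_vec 1
  · have h1 := radExp_flip i (fun r : ι → ℤˣ => sgn (r i) * sgn (r j))
    have h2 : (fun r : ι → ℤˣ => sgn (flipAt i r i) * sgn (flipAt i r j)) =
        fun r => (-1) * (sgn (r i) * sgn (r j)) := by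
      ext r; simp [flipAt, Function.update_of_ne (Ne.symm h), sgn_neg]
    rw [h2, radExp, prodExp_const_mul] at h1
    rw [radExp] at h1 ⊢
    linarith

lemma radExp_sgn (i : ι) : radExp (fun r : ι → ℤˣ => sgn (r i)) = 0 := by
  rw [radExp, prodExp_eval half_sum_vec i sgn]
  have : (Finset.univ : Finset ℤˣ) = {1, -1} := rfl
  rw [this, Finset.sum_pair (by decide)]; simp [sgn]

/-- The upper half of Khinchine's inequality. -/
lemma radExp_abs_sum_le (v : ι → ℝ) :
    radExp (fun r => |∑ i, sgn (r i) * v i|) ≤ √(∑ i, v i ^ 2) := by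
  -- The signs are orthonormal, so the second moment is exact; Jensen's inequality then bounds the
  -- first moment.
  have h : radExp (fun r => (∑ i, sgn (r i) * v i) ^ 2) = ∑ i, v i ^ 2 := by
    have : ∀ r : ι → ℤˣ, (∑ i, sgn (r i) * v i) ^ 2 =
        ∑ i, ∑ j, (v i * v j) * (sgn (r i) * sgn (r j)) := by
      intro r
      rw [sq, Finset.sum_mul_sum]
      exact Finset.sum_congr rfl fun i _ => Finset.sum_congr rfl fun j _ => by ring
    simp_rw [this]
    rw [radExp, prodExp_sum]
    refine Finset.sum_congr rfl fun i _ => ?_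
    rw [prodExp_sum]
    simp_rw [prodExp_const_mul]
    rw [Finset.sum_eq_single i]
    · have := radExp_mul_sgn i i; rw [radExp] at this; rw [this]; simp [sq]
    · intro j _ hj
      have := radExp_mul_sgn i j; rw [radExp] at this; rw [this]; simp [Ne.symm hj]
    · simp
  rw [← h]
  refine le_trans (le_of_eq ?_) (prodExp_sqrt_le half_nonneg_vec half_sum_vec fun r => sq_nonneg _)
  simp_rw [Real.sqrt_sq_eq_abs]; rfl

/-- The contraction principle in one coordinate. Take maximizers `k`, `l` of the two suprema on the
left. The sign of `v k` decides which supremum on the right is tested at `k`; the other is tested at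
`l`, where either sign of `v l` does at least as well as `-|v l|`. -/
lemma iSup_add_abs_le {κ : Type*} [Finite κ] [Nonempty κ] (c v : κ → ℝ) :
    (⨆ k, (c k + |v k|)) + (⨆ k, (c k - |v k|)) ≤ (⨆ k, (c k + v k)) + ⨆ k, (c k - v k) := by
  obtain ⟨k, hk⟩ := exists_eq_ciSup_of_finite (f := fun k => c k + |v k|)
  obtain ⟨l, hl⟩ := exists_eq_ciSup_of_finite (f := fun k => c k - |v k|)
  rw [← hk, ← hl]
  have h1 := le_ciSup_of_finite (fun k => c k + v k)
  have h2 := le_ciSup_of_finite (fun k => c k - v k)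
  rcases le_total 0 (v k) with h | h
  · rw [abs_of_nonneg h]
    linarith [h1 k, h2 l, le_abs_self (v l)]
  · rw [abs_of_nonpos h]
    linarith [h2 k, h1 l, neg_abs_le (v l)]

lemma iSup_sgn_abs_le {κ : Type*} [Finite κ] [Nonempty κ] (c v : κ → ℝ) (s : ℤˣ) :
    (⨆ k, (c k + sgn s * |v k|)) + (⨆ k, (c k + sgn (-s) * |v k|)) ≤
      (⨆ k, (c k + sgn s * v k)) + ⨆ k, (c k + sgn (-s) * v k) := by
  have h := iSup_add_abs_le c v
  rcases sgn_eq_one_or s with hs | hs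
  · simpa [sgn_neg, hs, sub_eq_add_neg] using h
  · simp only [sgn_neg, hs, neg_neg, one_mul, neg_mul]
    simp only [sub_eq_add_neg] at h
    linarith

/-- The contraction principle for the absolute value. -/
lemma radExp_iSup_abs_le {κ : Type*} [Finite κ] [Nonempty κ] (v : κ → ι → ℝ) :
    radExp (fun r => ⨆ k, ∑ i, sgn (r i) * |v k i|) ≤
      radExp (fun r => ⨆ k, ∑ i, sgn (r i) * v k i) := by
  -- Absolute values are introduced one coordinate at a time, `S` being the set of coordinates that
  -- carry them.
  have key : ∀ S : Finset ι,
      radExp (fun r => ⨆ k, ∑ i, sgn (r i) * (if i ∈ S then |v k i| else v k i)) ≤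
      radExp (fun r => ⨆ k, ∑ i, sgn (r i) * v k i) := by
    intro S
    induction S using Finset.induction_on with
    | empty => simp
    | insert j S hj ih =>
      refine le_trans ?_ ih
      set F : (ι → ℤˣ) → ℝ := fun r => ⨆ k, ∑ i, sgn (r i) *
        (if i ∈ insert j S then |v k i| else v k i) with hF
      set G : (ι → ℤˣ) → ℝ := fun r => ⨆ k, ∑ i, sgn (r i) *
        (if i ∈ S then |v k i| else v k i) with hG
      -- Pairing `r` with its flip at `j` isolates the `j`-th term with both signs; all other terms
      -- form the common function `c` below.
      have h2 : ∀ H : (ι → ℤˣ) → ℝ, 2 * radExp H = radExp (fun r => H r + H (flipAt j r)) := by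
        intro H
        rw [radExp, radExp, prodExp_add]
        have := radExp_flip j H
        rw [radExp, radExp] at this
        rw [this]; ring
      suffices 2 * radExp F ≤ 2 * radExp G by linarith
      rw [h2, h2]
      refine prodExp_mono half_nonneg_vec fun r => ?_
      set c : κ → ℝ := fun k => ∑ i ∈ Finset.univ.erase j, sgn (r i) *
        (if i ∈ S then |v k i| else v k i)
      have e1 : F r = ⨆ k, (c k + sgn (r j) * |v k j|) := by
        simp only [hF]; congr 1; ext k
        rw [← Finset.sum_erase_add _ _ (Finset.mem_univ j)]
        simp only [Finset.mem_insert, true_or, if_true, c]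
        congr 1
        exact Finset.sum_congr rfl fun i hi => by simp [Finset.ne_of_mem_erase hi]
      have e2 : F (flipAt j r) = ⨆ k, (c k + sgn (-r j) * |v k j|) := by
        simp only [hF]; congr 1; ext k
        rw [← Finset.sum_erase_add _ _ (Finset.mem_univ j)]
        simp only [Finset.mem_insert, true_or, if_true, c, flipAt, Function.update_self]
        congr 1
        exact Finset.sum_congr rfl fun i hi => by simp [Finset.ne_of_mem_erase hi]
      have e3 : G r = ⨆ k, (c k + sgn (r j) * v k j) := by
        simp only [hG]; congr 1; ext k
        rw [← Finset.sum_erase_add _ _ (Finset.mem_univ j)]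
        simp only [hj, if_false, c]
      have e4 : G (flipAt j r) = ⨆ k, (c k + sgn (-r j) * v k j) := by
        simp only [hG]; congr 1; ext k
        rw [← Finset.sum_erase_add _ _ (Finset.mem_univ j)]
        simp only [hj, if_false, c, flipAt, Function.update_self]
        congr 1
        exact Finset.sum_congr rfl fun i hi => by
          simp [Function.update_of_ne (Finset.ne_of_mem_erase hi)]
      rw [e1, e2, e3, e4]
      exact iSup_sgn_abs_le c (fun k => v k j) (r j)
  simpa using key Finset.univ

/-- Symmetrization: the expected uniform deviation of an empirical sum over a finite class is at
most twice its Rademacher average. -/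
lemma prodExp_iSup_sub_le (hp : ∀ i a, 0 ≤ p i a) (h1 : ∀ i, ∑ a, p i a = 1)
    {κ : Type*} [Finite κ] [Nonempty κ] (h : κ → α → ℝ) :
    prodExp p (fun a => ⨆ k, ∑ i, (h k (a i) - ∑ c, p i c * h k c)) ≤
      2 * prodExp p (fun a => radExp (fun r => ⨆ k, ∑ i, sgn (r i) * h k (a i))) := by
  set D : (ι → α) → (ι → α) → (ι → ℤˣ) → ℝ :=
    fun a b r => ⨆ k, ∑ i, sgn (r i) * (h k (a i) - h k (b i)) with hD
  -- The mean is the expectation over a ghost sample `b`, and the supremum of an expectation is at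
  -- most the expectation of the supremum.
  have s1 : prodExp p (fun a => ⨆ k, ∑ i, (h k (a i) - ∑ c, p i c * h k c)) ≤
      prodExp p (fun a => prodExp p (fun b => D a b 1)) := by
    refine prodExp_mono hp fun a => ciSup_le fun k => ?_
    have : ∑ i, (h k (a i) - ∑ c, p i c * h k c) =
        prodExp p (fun b => ∑ i, (h k (a i) + (-1) * h k (b i))) := by
      rw [prodExp_sum]
      refine Finset.sum_congr rfl fun i _ => ?_
      rw [prodExp_add, prodExp_const h1, prodExp_const_mul, prodExp_eval h1 i (h k)]
      ring
    rw [this]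
    refine prodExp_mono hp fun b => ?_
    refine le_trans (le_of_eq ?_) (le_ciSup_of_finite _ k)
    exact Finset.sum_congr rfl fun i _ => by simp [sgn]; ring
  -- Exchanging `a i` and `b i` wherever `r i = -1` changes the sign of exactly those differences.
  have s2 : ∀ r : ι → ℤˣ, prodExp p (fun a => prodExp p (fun b => D a b 1)) =
      prodExp p (fun a => prodExp p (fun b => D a b r)) := by
    intro r
    rw [prodExp_swap (Finset.univ.filter fun i => r i = 1)]
    congr 1; ext a; congr 1; ext b
    simp only [hD]; congr 1; ext k
    refine Finset.sum_congr rfl fun i _ => ?_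
    rcases Int.units_eq_one_or (r i) with hr | hr <;>
      simp [Finset.piecewise, hr, sgn]
  have s3 : prodExp p (fun a => prodExp p (fun b => D a b 1)) =
      prodExp p (fun a => prodExp p (fun b => radExp (fun r => D a b r))) := by
    have e1 : ∀ a, prodExp p (fun b => radExp (fun r => D a b r)) =
        radExp (fun r => prodExp p (fun b => D a b r)) := fun a => prodExp_comm _ _
    simp_rw [e1]
    have e2 : prodExp p (fun a => radExp (fun r => prodExp p (fun b => D a b r))) =
      radExp (fun r => prodExp p (fun a => prodExp p (fun b => D a b r))) := prodExp_comm _ _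
    rw [e2]
    simp_rw [← s2]
    exact (prodExp_const half_sum_vec _).symm
  have s4 : ∀ a b, radExp (fun r => D a b r) ≤
      radExp (fun r => ⨆ k, ∑ i, sgn (r i) * h k (a i)) +
        radExp (fun r => ⨆ k, ∑ i, sgn (r i) * h k (b i)) := by
    intro a b
    rw [← radExp_neg (fun r => ⨆ k, ∑ i, sgn (r i) * h k (b i)), radExp, radExp, radExp,
      ← prodExp_add]
    refine prodExp_mono half_nonneg_vec fun r => ciSup_le fun k => ?_
    refine le_trans (le_of_eq ?_) (add_le_add
      (le_ciSup_of_finite (fun k => ∑ i, sgn (r i) * h k (a i)) k)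
      (le_ciSup_of_finite (fun k => ∑ i, sgn (-r i) * h k (b i)) k))
    rw [← Finset.sum_add_distrib]
    exact Finset.sum_congr rfl fun i _ => by rw [sgn_neg]; ring
  rw [s3] at s1
  refine s1.trans ?_
  calc _ ≤ prodExp p (fun a => prodExp p (fun b =>
        radExp (fun r => ⨆ k, ∑ i, sgn (r i) * h k (a i)) +
        radExp (fun r => ⨆ k, ∑ i, sgn (r i) * h k (b i)))) :=
        prodExp_mono hp fun a => prodExp_mono hp fun b => s4 a b
    _ = _ := by
        simp_rw [prodExp_add, prodExp_const h1]
        ring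

end ProdExp

/-! ### Sampling rows, columns and class counts. -/

section Sampling

variable {ι α : Type*} [Fintype ι] [Fintype α] [DecidableEq ι] {p : ι → α → ℝ}

lemma sum_sqrt_le {κ : Type*} [Fintype κ] (x : κ → ℝ) (hx : ∀ k, 0 ≤ x k) :
    ∑ k, √(x k) ≤ √(Fintype.card κ * ∑ k, x k) := by
  have := Real.sum_sqrt_mul_sqrt_le (Finset.univ : Finset κ) (f := fun _ => 1) (g := x)
    (fun _ => zero_le_one) hx
  simpa [Real.sqrt_mul] using this

lemma prodExp_sum_eval (h1 : ∀ i, ∑ a, p i a = 1) (h : α → ℝ) :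
    prodExp p (fun a => ∑ i, h (a i)) = ∑ c, (∑ i, p i c) * h c := by
  rw [prodExp_sum]
  simp_rw [prodExp_eval h1, Finset.sum_mul]
  exact Finset.sum_comm

/-- Khinchine for a fixed sample, then Jensen over the sample. The bound sees the laws `p i` only
through their sum. -/
lemma prodExp_radExp_abs_le (hp : ∀ i a, 0 ≤ p i a) (h1 : ∀ i, ∑ a, p i a = 1) (g : α → ℝ) :
    prodExp p (fun a => radExp (fun r => |∑ i, sgn (r i) * g (a i)|)) ≤
      √(∑ c, (∑ i, p i c) * g c ^ 2) := by
  rw [← prodExp_sum_eval h1 (fun c => g c ^ 2)]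
  exact (prodExp_mono hp fun a => radExp_abs_sum_le _).trans
    (prodExp_sqrt_le hp h1 fun a => Finset.sum_nonneg fun i _ => sq_nonneg _)

/-- Sampling a finite class of functions in `L¹`. -/
lemma prodExp_iSup_sum_abs_le (hp : ∀ i a, 0 ≤ p i a) (h1 : ∀ i, ∑ a, p i a = 1)
    {κ : Type*} [Finite κ] [Nonempty κ] (h : κ → α → ℝ) :
    prodExp p (fun a => ⨆ k, ∑ i, |h k (a i)|) ≤ (⨆ k, ∑ c, (∑ i, p i c) * |h k c|) +
      2 * prodExp p (fun a => radExp (fun r => ⨆ k, ∑ i, sgn (r i) * h k (a i))) := by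
  have hs := prodExp_iSup_sub_le hp h1 (fun k c => |h k c|)
  -- Contraction removes the absolute values; in the applications to kernels the resulting average
  -- is linear in the signs that index the class.
  have hc : prodExp p (fun a => radExp (fun r => ⨆ k, ∑ i, sgn (r i) * |h k (a i)|)) ≤
      prodExp p (fun a => radExp (fun r => ⨆ k, ∑ i, sgn (r i) * h k (a i))) :=
    prodExp_mono hp fun a => radExp_iSup_abs_le (fun k i => h k (a i))
  have hle : prodExp p (fun a => ⨆ k, ∑ i, |h k (a i)|) ≤
      prodExp p (fun a => (⨆ k, ∑ c, (∑ i, p i c) * |h k c|) +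
        ⨆ k, ∑ i, (|h k (a i)| - ∑ c, p i c * |h k c|)) := by
    refine prodExp_mono hp fun a => ciSup_le fun k => ?_
    refine le_trans (le_of_eq ?_) (add_le_add
      (le_ciSup_of_finite (fun k => ∑ c, (∑ i, p i c) * |h k c|) k)
      (le_ciSup_of_finite (fun k => ∑ i, (|h k (a i)| - ∑ c, p i c * |h k c|)) k))
    simp_rw [Finset.sum_sub_distrib, Finset.sum_mul]
    rw [Finset.sum_comm (s := (Finset.univ : Finset α))]
    ring
  rw [prodExp_add, prodExp_const h1] at hle
  linarith

/-- Sampling the rows and, independently, the columns of a kernel. -/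
lemma prodExp_prodExp_signNorm_le (hp : ∀ i a, 0 ≤ p i a) (h1 : ∀ i, ∑ a, p i a = 1)
    (V : α → α → ℝ) :
    prodExp p (fun a => prodExp p (fun b => signNorm (fun i j => V (a i) (b j)))) ≤
      signNorm (fun a b => (∑ i, p i a) * (∑ i, p i b) * V a b) +
        4 * √(Fintype.card ι * ∑ a, ∑ b, (∑ i, p i a) * (∑ i, p i b) * V a b ^ 2) := by
  set q : α → ℝ := fun c => ∑ i, p i c with hq
  have hq0 : ∀ c, 0 ≤ q c := fun c => Finset.sum_nonneg fun i _ => hp i c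
  have hqN : ∑ c, q c = Fintype.card ι := by
    rw [Finset.sum_comm]; simp [h1]
  -- With the rows fixed, the columns are sampled for the class indexed by the row signs. In the
  -- mean term, duality replaces row signs by column signs `t` on all of `α`; a class independent of
  -- `a` results, and the rows can be sampled in the same way.
  have cols : ∀ a : ι → α, prodExp p (fun b => signNorm (fun i j => V (a i) (b j))) ≤
      (⨆ t : α → ℤˣ, ∑ i, |∑ c, q c * (sgn (t c) * V (a i) c)|) +
        2 * ∑ i, √(∑ c, q c * V (a i) c ^ 2) := by
    intro a
    have e1 : prodExp p (fun b => signNorm (fun i j => V (a i) (b j))) ≤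
        prodExp p (fun b => ⨆ s : ι → ℤˣ, ∑ j, |∑ i, sgn (s i) * V (a i) (b j)|) :=
      prodExp_mono hp fun b => signNorm_le fun s t => (sum_sgn_le_sum_abs_col _ s t).trans
        (le_ciSup_of_finite (fun s : ι → ℤˣ => ∑ j, |∑ i, sgn (s i) * V (a i) (b j)|) s)
    refine e1.trans ((prodExp_iSup_sum_abs_le hp h1
      (fun (s : ι → ℤˣ) c => ∑ i, sgn (s i) * V (a i) c)).trans (add_le_add ?_ ?_))
    · refine ciSup_le fun s => ?_
      choose t ht using fun c => exists_sgn_mul_eq_abs (∑ i, sgn (s i) * V (a i) c)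
      refine le_trans ?_ (le_ciSup_of_finite
        (fun t : α → ℤˣ => ∑ i, |∑ c, q c * (sgn (t c) * V (a i) c)|) t)
      calc _ = ∑ i, sgn (s i) * ∑ c, q c * (sgn (t c) * V (a i) c) := by
            simp_rw [← ht, Finset.mul_sum]
            rw [Finset.sum_comm]
            exact Finset.sum_congr rfl fun b _ => Finset.sum_congr rfl fun a _ => by ring
        _ ≤ _ := Finset.sum_le_sum fun i _ => sgn_mul_le_abs _ _
    · refine mul_le_mul_of_nonneg_left ?_ (by norm_num)
      -- The expression is linear in `s`, so its supremum is at most a sum of absolute values over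
      -- the rows. Each is a single Rademacher sum, and the size of the class `{±1}^ι` does not
      -- enter.
      calc _ ≤ prodExp p (fun b => radExp (fun r : ι → ℤˣ =>
            ∑ i, |∑ j, sgn (r j) * V (a i) (b j)|)) := by
            refine prodExp_mono hp fun b => prodExp_mono half_nonneg_vec fun r =>
              ciSup_le fun s => ?_
            simp_rw [Finset.mul_sum]
            rw [Finset.sum_comm]
            refine Finset.sum_le_sum fun i _ => ?_
            refine le_trans (le_of_eq ?_) (sgn_mul_le_abs (s i) _)
            rw [Finset.mul_sum]
            exact Finset.sum_congr rfl fun j _ => by ring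
        _ = ∑ i, prodExp p (fun b => radExp (fun r : ι → ℤˣ =>
              |∑ j, sgn (r j) * V (a i) (b j)|)) := by
            simp_rw [radExp, prodExp_sum]
        _ ≤ _ := Finset.sum_le_sum fun i _ => prodExp_radExp_abs_le hp h1 fun c => V (a i) c
  refine (prodExp_mono hp cols).trans ?_
  rw [prodExp_add, prodExp_const_mul]
  have rows : prodExp p
      (fun a => ⨆ t : α → ℤˣ, ∑ i, |∑ c, q c * (sgn (t c) * V (a i) c)|) ≤
      signNorm (fun a b => q a * q b * V a b) +
        2 * ∑ c, q c * √(∑ a, q a * V a c ^ 2) := by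
    refine (prodExp_iSup_sum_abs_le hp h1
      (fun (t : α → ℤˣ) a => ∑ c, q c * (sgn (t c) * V a c))).trans (add_le_add ?_ ?_)
    · refine ciSup_le fun t => ?_
      refine le_trans (le_of_eq ?_) (sum_abs_row_le_signNorm _ t)
      refine Finset.sum_congr rfl fun a _ => ?_
      change q a * _ = _
      rw [← abs_of_nonneg (hq0 a), ← abs_mul, abs_of_nonneg (hq0 a), Finset.mul_sum]
      congr 1
      exact Finset.sum_congr rfl fun b _ => by ring
    · refine mul_le_mul_of_nonneg_left ?_ (by norm_num)
      calc _ ≤ prodExp p (fun a => radExp (fun r : ι → ℤˣ =>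
            ∑ c, q c * |∑ i, sgn (r i) * V (a i) c|)) := by
            refine prodExp_mono hp fun a => prodExp_mono half_nonneg_vec fun r =>
              ciSup_le fun t => ?_
            simp_rw [Finset.mul_sum]
            rw [Finset.sum_comm]
            refine Finset.sum_le_sum fun c _ => ?_
            refine le_trans (le_of_eq ?_)
              (mul_le_mul_of_nonneg_left (sgn_mul_le_abs (t c) (∑ i, sgn (r i) * V (a i) c)) (hq0 c))
            rw [Finset.mul_sum, Finset.mul_sum]
            exact Finset.sum_congr rfl fun j _ => by ring
        _ = ∑ c, q c * prodExp p (fun a => radExp (fun r : ι → ℤˣ =>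
              |∑ i, sgn (r i) * V (a i) c|)) := by
            simp_rw [radExp, prodExp_sum, prodExp_const_mul]
        _ ≤ _ := Finset.sum_le_sum fun c _ =>
            mul_le_mul_of_nonneg_left (prodExp_radExp_abs_le hp h1 fun a => V a c) (hq0 c)
  -- Cauchy–Schwarz with total mass `∑ q = card ι`. Both Rademacher errors get the same bound,
  -- whence the factor `4 = 2 + 2`.
  have r1 : ∑ c, q c * √(∑ a, q a * V a c ^ 2) ≤
      √(Fintype.card ι * ∑ a, ∑ b, q a * q b * V a b ^ 2) := by
    have hnn : ∀ c, 0 ≤ ∑ a, q a * V a c ^ 2 := fun c =>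
      Finset.sum_nonneg fun a _ => mul_nonneg (hq0 a) (sq_nonneg _)
    have := Real.sum_sqrt_mul_sqrt_le (Finset.univ : Finset α) (f := q)
      (g := fun c => q c * ∑ a, q a * V a c ^ 2) hq0 (fun c => mul_nonneg (hq0 c) (hnn c))
    rw [hqN, ← Real.sqrt_mul (Nat.cast_nonneg _)] at this
    refine le_trans (le_of_eq ?_) (this.trans (le_of_eq ?_))
    · refine Finset.sum_congr rfl fun c _ => ?_
      rw [Real.sqrt_mul (hq0 c), ← mul_assoc, Real.mul_self_sqrt (hq0 c)]
    · congr 2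
      simp_rw [Finset.mul_sum]
      rw [Finset.sum_comm]
      exact Finset.sum_congr rfl fun b _ => Finset.sum_congr rfl fun a _ => by ring
  have r2 : prodExp p (fun a => ∑ i, √(∑ c, q c * V (a i) c ^ 2)) ≤
      √(Fintype.card ι * ∑ a, ∑ b, q a * q b * V a b ^ 2) := by
    have hnn : ∀ a, 0 ≤ ∑ c, q c * V a c ^ 2 := fun a =>
      Finset.sum_nonneg fun c _ => mul_nonneg (hq0 c) (sq_nonneg _)
    refine (prodExp_mono hp fun a => sum_sqrt_le _ fun i => hnn (a i)).trans ?_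
    refine (prodExp_sqrt_le hp h1 fun a =>
      mul_nonneg (Nat.cast_nonneg _) (Finset.sum_nonneg fun i _ => hnn (a i))).trans
      (le_of_eq ?_)
    rw [prodExp_const_mul, prodExp_sum_eval h1 (fun a => ∑ c, q c * V a c ^ 2)]
    congr 2
    refine Finset.sum_congr rfl fun b _ => ?_
    rw [Finset.mul_sum]
    exact Finset.sum_congr rfl fun a _ => by ring
  linarith

/-- Decoupling: the rows and the columns of the off-diagonal part may be sampled independently. -/
lemma prodExp_signNorm_offDiag_le (hp : ∀ i a, 0 ≤ p i a) (h1 : ∀ i, ∑ a, p i a = 1)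
    (V : α → α → ℝ) :
    prodExp p (fun a => signNorm (fun i j => if i = j then 0 else V (a i) (a j))) ≤
      4 * prodExp p (fun a => prodExp p (fun b => signNorm (fun i j => V (a i) (b j)))) := by
  -- `σ` and `τ` are the indicators of `r = 1` and `r = -1`. A random split separates `i` from `j ≠
  -- i` in this order with probability `1 / 4` and never separates `i` from itself: hence the factor
  -- `4` and the exclusion of the diagonal.
  set σ : (ι → ℤˣ) → ι → ℝ := fun r i => (1 + sgn (r i)) / 2 with hσ
  set τ : (ι → ℤˣ) → ι → ℝ := fun r i => (1 - sgn (r i)) / 2 with hτ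
  have hσ1 : ∀ r i, |σ r i| ≤ 1 := fun r i => by
    rcases sgn_eq_one_or (r i) with h | h <;> simp [hσ, h]
  have hτ1 : ∀ r i, |τ r i| ≤ 1 := fun r i => by
    rcases sgn_eq_one_or (r i) with h | h <;> norm_num [hτ, h]
  have avg : ∀ i j, radExp (fun r => σ r i * τ r j) = if i = j then 0 else 1 / 4 := by
    intro i j
    have : (fun r : ι → ℤˣ => σ r i * τ r j) = fun r => (1 / 4 : ℝ) * (((1 : ℝ) + sgn (r i)) +
        ((-1) * sgn (r j) + (-1) * (sgn (r i) * sgn (r j)))) := by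
      ext r; simp only [hσ, hτ]; ring
    have a1 := radExp_sgn i
    have a2 := radExp_sgn j
    have a3 := radExp_mul_sgn i j
    rw [radExp] at a1 a2 a3
    rw [this, radExp, prodExp_const_mul, prodExp_add, prodExp_add, prodExp_add,
      prodExp_const_mul, prodExp_const_mul, prodExp_const half_sum_vec, a1, a2, a3]
    split_ifs <;> norm_num
  have pointwise : ∀ a : ι → α,
      signNorm (fun i j => if i = j then 0 else V (a i) (a j)) ≤
      4 * radExp (fun r => signNorm (fun i j => σ r i * τ r j * V (a i) (a j))) := by
    intro a
    refine signNorm_le fun s t => ?_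
    calc _ = 4 * radExp (fun r => ∑ i, ∑ j,
          sgn (s i) * sgn (t j) * (σ r i * τ r j * V (a i) (a j))) := by
          simp_rw [radExp, prodExp_sum, Finset.mul_sum]
          refine Finset.sum_congr rfl fun i _ => Finset.sum_congr rfl fun j _ => ?_
          have : (fun r => sgn (s i) * sgn (t j) * (σ r i * τ r j * V (a i) (a j))) =
              fun r => (sgn (s i) * sgn (t j) * V (a i) (a j)) * (σ r i * τ r j) := by
            ext r; ring
          rw [this, prodExp_const_mul]
          have := avg i j
          rw [radExp] at this
          rw [this]
          split_ifs <;> ring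
      _ ≤ _ := by
          refine mul_le_mul_of_nonneg_left ?_ (by norm_num)
          exact prodExp_mono half_nonneg_vec fun r => sum_sgn_le_signNorm _ s t
  -- For a fixed split, rows use only indices with `r = 1` and columns only those with `r = -1`, so
  -- the columns may be read from an independent copy. The cut-offs `σ`, `τ` are then absorbed as
  -- test weights of size at most one.
  have indep : ∀ r : ι → ℤˣ,
      prodExp p (fun a => signNorm (fun i j => σ r i * τ r j * V (a i) (a j))) ≤
      prodExp p (fun a => prodExp p (fun b => signNorm (fun i j => V (a i) (b j)))) := by
    intro r
    have e1 : prodExp p (fun a => signNorm (fun i j => σ r i * τ r j * V (a i) (a j))) =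
        prodExp p (fun a => prodExp p
          (fun b => signNorm (fun i j => σ r i * τ r j * V (a i) (b j)))) := by
      rw [prodExp_swap (Finset.univ.filter fun i => r i = 1)]
      have : ∀ a b : ι → α, (fun i j => σ r i * τ r j *
          V ((Finset.univ.filter fun i => r i = 1).piecewise a b i)
            ((Finset.univ.filter fun i => r i = 1).piecewise b a j)) =
          fun i j => σ r i * τ r j * V (a i) (a j) := by
        intro a b
        ext i j
        rcases Int.units_eq_one_or (r i) with hi | hi <;>
        rcases Int.units_eq_one_or (r j) with hj | hj <;>
          simp [Finset.piecewise, hi, hj, hσ, hτ, sgn]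
      simp_rw [this, prodExp_const h1]
    rw [e1]
    refine prodExp_mono hp fun a => prodExp_mono hp fun b => signNorm_le fun s t => ?_
    refine le_trans (le_of_eq ?_) (sum_mul_le_signNorm (fun i j => V (a i) (b j))
      (σ := fun i => sgn (s i) * σ r i) (τ := fun j => sgn (t j) * τ r j) ?_ ?_)
    · exact Finset.sum_congr rfl fun i _ => Finset.sum_congr rfl fun j _ => by ring
    · intro i; rw [abs_mul, abs_sgn, one_mul]; exact hσ1 r i
    · intro i; rw [abs_mul, abs_sgn, one_mul]; exact hτ1 r i
  refine (prodExp_mono hp pointwise).trans ?_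
  rw [prodExp_const_mul]
  refine mul_le_mul_of_nonneg_left ?_ (by norm_num)
  have : prodExp p (fun a => radExp (fun r =>
      signNorm (fun i j => σ r i * τ r j * V (a i) (a j)))) =
      radExp (fun r => prodExp p (fun a =>
        signNorm (fun i j => σ r i * τ r j * V (a i) (a j)))) := prodExp_comm _ _
  rw [this, ← prodExp_const (half_sum_vec (ι := ι))
    (prodExp p (fun a => prodExp p (fun b => signNorm (fun i j => V (a i) (b j)))))]
  exact prodExp_mono half_nonneg_vec indep

/-- The empirical counts of `K` classes deviate from their means by at most `2 √(K N)` in total. -/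
lemma prodExp_sum_abs_count_sub_le (hp : ∀ i a, 0 ≤ p i a) (h1 : ∀ i, ∑ a, p i a = 1)
    {κ : Type*} [Fintype κ] [DecidableEq κ] (g : α → κ) :
    prodExp p (fun a => ∑ c, |(∑ i, if g (a i) = c then (1 : ℝ) else 0) -
        ∑ b, (∑ i, p i b) * if g b = c then (1 : ℝ) else 0|) ≤
      2 * √(Fintype.card κ * Fintype.card ι) := by
  have hsel : ∀ (t : κ → ℤˣ) (b : α),
      sgn (t (g b)) = ∑ c, sgn (t c) * if g b = c then (1 : ℝ) else 0 := by
    intro t b; simp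
  -- The `ℓ¹` deviation of the counts is the largest deviation among the functions `sgn ∘ t ∘ g`, so
  -- symmetrization applies. Khinchine in each class and Cauchy–Schwarz over classes finish, because
  -- the counts add up to `card ι`.
  have hle : ∀ a : ι → α, ∑ c, |(∑ i, if g (a i) = c then (1 : ℝ) else 0) -
        ∑ b, (∑ i, p i b) * if g b = c then (1 : ℝ) else 0| ≤
      ⨆ t : κ → ℤˣ, ∑ i, (sgn (t (g (a i))) - ∑ b, p i b * sgn (t (g b))) := by
    intro a
    choose t ht using fun c => exists_sgn_mul_eq_abs
      ((∑ i, if g (a i) = c then (1 : ℝ) else 0) -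
        ∑ b, (∑ i, p i b) * if g b = c then (1 : ℝ) else 0)
    refine le_trans (le_of_eq ?_) (le_ciSup_of_finite (fun t : κ → ℤˣ =>
      ∑ i, (sgn (t (g (a i))) - ∑ b, p i b * sgn (t (g b)))) t)
    simp_rw [← ht, mul_sub, Finset.sum_sub_distrib, Finset.mul_sum]
    congr 1
    · rw [Finset.sum_comm]
      exact Finset.sum_congr rfl fun i _ => (hsel t (a i)).symm
    · rw [Finset.sum_comm, Finset.sum_comm (s := (Finset.univ : Finset ι))]
      refine Finset.sum_congr rfl fun b _ => ?_
      rw [← Finset.sum_mul, hsel t b, Finset.mul_sum]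
      exact Finset.sum_congr rfl fun c _ => by ring
  refine (prodExp_mono hp hle).trans ((prodExp_iSup_sub_le hp h1
    (fun (t : κ → ℤˣ) b => sgn (t (g b)))).trans ?_)
  refine mul_le_mul_of_nonneg_left ?_ (by norm_num)
  rw [← prodExp_const h1 (√(Fintype.card κ * Fintype.card ι))]
  refine prodExp_mono hp fun a => ?_
  calc _ ≤ radExp (fun r : ι → ℤˣ =>
        ∑ c, |∑ i, sgn (r i) * if g (a i) = c then (1 : ℝ) else 0|) := by
        refine prodExp_mono half_nonneg_vec fun r => ciSup_le fun t => ?_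
        simp_rw [hsel t, Finset.mul_sum]
        rw [Finset.sum_comm]
        refine Finset.sum_le_sum fun c _ => ?_
        refine le_trans (le_of_eq ?_) (sgn_mul_le_abs (t c) _)
        rw [Finset.mul_sum]
        exact Finset.sum_congr rfl fun i _ => by ring
    _ = ∑ c, radExp (fun r : ι → ℤˣ =>
          |∑ i, sgn (r i) * if g (a i) = c then (1 : ℝ) else 0|) := by
        simp_rw [radExp, prodExp_sum]
    _ ≤ ∑ c, √(∑ i, (if g (a i) = c then (1 : ℝ) else 0) ^ 2) :=
        Finset.sum_le_sum fun c _ => radExp_abs_sum_le _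
    _ ≤ √(Fintype.card κ * ∑ c, ∑ i, (if g (a i) = c then (1 : ℝ) else 0) ^ 2) :=
        sum_sqrt_le _ fun c => Finset.sum_nonneg fun i _ => sq_nonneg _
    _ = √(Fintype.card κ * Fintype.card ι) := by
        congr 2
        rw [Finset.sum_comm]
        simp

end Sampling

/-! ### Weak regularity by energy decrement. -/

section Regularity

variable {α : Type*} [Fintype α]

/-- The weak regularity lemma: a bounded kernel is close in sign norm to a combination
`ε ∑ s_l ⊗ t_l` of few sign rectangles. -/
lemma exists_sign_rectangles (ω : α → α → ℝ) (hω : ∀ a b, 0 ≤ ω a b)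
    (hω1 : ∑ a, ∑ b, ω a b = 1) (W : α → α → ℝ) {B ε : ℝ} (hε : 0 < ε)
    (hW : ∀ a b, |W a b| ≤ B) {k₀ : ℕ} (hk : B ^ 2 ≤ k₀ * ε ^ 2) :
    ∃ k ≤ k₀, ∃ s t : Fin k → α → ℤˣ,
      ∑ a, ∑ b, ω a b * (W a b - ε * ∑ l, sgn (s l a) * sgn (t l b)) ^ 2 ≤ B ^ 2 ∧
      signNorm (fun a b => ω a b * (W a b - ε * ∑ l, sgn (s l a) * sgn (t l b))) ≤ ε := by
  by_contra! hcon
  -- If the remainder has correlation above `ε` with a sign rectangle, subtracting `ε` times that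
  -- rectangle changes the energy by less than `-2ε² + ε² = -ε²`; `k₀ + 1` such steps would make it
  -- negative. The coefficient is always `ε`, not the correlation, which keeps the sum of rectangles
  -- bounded by `ε k₀`.
  have key : ∀ n ≤ k₀ + 1, ∃ s t : Fin n → α → ℤˣ,
      ∑ a, ∑ b, ω a b * (W a b - ε * ∑ l, sgn (s l a) * sgn (t l b)) ^ 2 ≤
        B ^ 2 - n * ε ^ 2 := by
    intro n
    induction n with
    | zero =>
      intro _
      refine ⟨Fin.elim0, Fin.elim0, ?_⟩
      calc _ ≤ ∑ a, ∑ b, ω a b * B ^ 2 := by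
            refine Finset.sum_le_sum fun a _ => Finset.sum_le_sum fun b _ =>
              mul_le_mul_of_nonneg_left ?_ (hω a b)
            simpa using sq_le_sq' (abs_le.1 (hW a b)).1 (abs_le.1 (hW a b)).2
        _ = _ := by simp_rw [← Finset.sum_mul]; rw [hω1]; simp
    | succ n ih =>
      intro hn
      obtain ⟨s, t, hst⟩ := ih (by omega)
      have hB : ∑ a, ∑ b, ω a b * (W a b - ε * ∑ l, sgn (s l a) * sgn (t l b)) ^ 2 ≤ B ^ 2 :=
        hst.trans (by have : 0 ≤ (n : ℝ) * ε ^ 2 := by positivity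
                      linarith)
      have hlt := hcon n (by omega) s t hB
      set V : α → α → ℝ := fun a b => W a b - ε * ∑ l, sgn (s l a) * sgn (t l b) with hV
      obtain ⟨s', t', h'⟩ : ∃ (s' t' : α → ℤˣ),
          ε < ∑ a, ∑ b, sgn (s' a) * sgn (t' b) * (ω a b * V a b) := by
        by_contra! hc
        exact absurd (signNorm_le hc) (not_le.2 hlt)
      refine ⟨Fin.snoc s s', Fin.snoc t t', ?_⟩
      have e : ∀ a b, ω a b * (W a b - ε * ∑ l : Fin (n + 1),
          sgn ((Fin.snoc s s' : Fin (n + 1) → α → ℤˣ) l a) *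
            sgn ((Fin.snoc t t' : Fin (n + 1) → α → ℤˣ) l b)) ^ 2 =
          ω a b * V a b ^ 2 - 2 * ε * (sgn (s' a) * sgn (t' b) * (ω a b * V a b)) +
            ω a b * ε ^ 2 := by
        intro a b
        rw [Fin.sum_univ_castSucc]
        simp only [Fin.snoc_castSucc, Fin.snoc_last, hV]
        linear_combination (ω a b * ε ^ 2 * (sgn (t' b) * sgn (t' b))) * sgn_mul_self (s' a) +
          (ω a b * ε ^ 2) * sgn_mul_self (t' b)
      simp_rw [e, Finset.sum_add_distrib, Finset.sum_sub_distrib, ← Finset.mul_sum,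
        ← Finset.sum_mul]
      rw [hω1]
      push_cast
      nlinarith [mul_lt_mul_of_pos_left h' hε]
  obtain ⟨s, t, h⟩ := key (k₀ + 1) le_rfl
  have h0 : 0 ≤ ∑ a, ∑ b, ω a b * (W a b - ε * ∑ l, sgn (s l a) * sgn (t l b)) ^ 2 :=
    Finset.sum_nonneg fun a _ => Finset.sum_nonneg fun b _ => mul_nonneg (hω a b) (sq_nonneg _)
  push_cast at h
  nlinarith [pow_pos hε 2]

end Regularity

/-! ### Sampling a finite kernel, normalized and with its diagonal. -/

section FiniteSampling

variable {ι α : Type*} [Fintype ι] [Fintype α] [DecidableEq ι] {p : ι → α → ℝ}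

/-- The sign norm of a sampled kernel, diagonal included, in terms of the sign norm and of the
`L²` norm of the kernel. -/
lemma prodExp_signNorm_sample_le [Nonempty ι] (hp : ∀ i a, 0 ≤ p i a)
    (h1 : ∀ i, ∑ a, p i a = 1) (V : α → α → ℝ) {M : ℝ} (hM : ∀ a, |V a a| ≤ M) {P : α → ℝ}
    (hP : ∀ a, P a = (Fintype.card ι : ℝ)⁻¹ * ∑ i, p i a) :
    prodExp p (fun a => signNorm (fun i j : ι =>
        (Fintype.card ι : ℝ)⁻¹ * (Fintype.card ι : ℝ)⁻¹ * V (a i) (a j))) ≤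
      4 * signNorm (fun a b => P a * P b * V a b) +
        16 * √((Fintype.card ι : ℝ)⁻¹ * ∑ a, ∑ b, P a * P b * V a b ^ 2) +
        (Fintype.card ι : ℝ)⁻¹ * M := by
  set n : ℝ := (Fintype.card ι : ℝ) with hn
  have hn0 : 0 < n := by simp only [hn]; exact_mod_cast Fintype.card_pos
  have hq : ∀ a, ∑ i, p i a = n * P a := fun a => by rw [hP a]; field_simp
  have hmain := (prodExp_signNorm_offDiag_le hp h1 V).trans
    (mul_le_mul_of_nonneg_left (prodExp_prodExp_signNorm_le hp h1 V) (by norm_num))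
  simp_rw [hq] at hmain
  have e1 : signNorm (fun a b => n * P a * (n * P b) * V a b) =
      n * n * signNorm (fun a b => P a * P b * V a b) := by
    rw [← signNorm_const_mul (by positivity)]
    congr 1; ext a b; ring
  have e2 : √(n * ∑ a, ∑ b, n * P a * (n * P b) * V a b ^ 2) =
      n * n * √(n⁻¹ * ∑ a, ∑ b, P a * P b * V a b ^ 2) := by
    have : n * ∑ a, ∑ b, n * P a * (n * P b) * V a b ^ 2 =
        (n * n) ^ 2 * (n⁻¹ * ∑ a, ∑ b, P a * P b * V a b ^ 2) := by
      simp_rw [Finset.mul_sum]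
      refine Finset.sum_congr rfl fun a _ => Finset.sum_congr rfl fun b _ => ?_
      field_simp
    rw [this, Real.sqrt_mul (by positivity), Real.sqrt_sq (by positivity)]
  rw [e1, e2] at hmain
  have hpt : ∀ a : ι → α, signNorm (fun i j : ι => n⁻¹ * n⁻¹ * V (a i) (a j)) ≤
      n⁻¹ * n⁻¹ * signNorm (fun i j => if i = j then 0 else V (a i) (a j)) + n⁻¹ * M := by
    intro a
    rw [signNorm_const_mul (by positivity)]
    -- The diagonal has only `n` entries of size at most `M`, so it costs `M / n` after division by
    -- `n²`.
    have hd : signNorm (fun i j => V (a i) (a j)) ≤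
        signNorm (fun i j => if i = j then 0 else V (a i) (a j)) + n * M := by
      have := signNorm_add_le (fun i j => if i = j then 0 else V (a i) (a j))
        (fun i j => if i = j then V (a i) (a j) else 0)
      refine le_trans (le_of_eq ?_) (this.trans (add_le_add le_rfl
        ((signNorm_le_sum_abs _).trans ?_)))
      · congr 1; ext i j; split_ifs <;> simp
      · calc _ = ∑ i, |V (a i) (a i)| := by
              refine Finset.sum_congr rfl fun i _ => ?_
              rw [Finset.sum_eq_single i] <;> simp +contextual [eq_comm]
          _ ≤ ∑ _i : ι, M := Finset.sum_le_sum fun i _ => hM (a i)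
          _ = n * M := by simp [hn]
    calc _ ≤ n⁻¹ * n⁻¹ * (signNorm (fun i j => if i = j then 0 else V (a i) (a j)) + n * M) :=
          mul_le_mul_of_nonneg_left hd (by positivity)
      _ = _ := by field_simp
  refine (prodExp_mono hp hpt).trans ?_
  rw [prodExp_add, prodExp_const h1, prodExp_const_mul]
  have := mul_le_mul_of_nonneg_left hmain (show 0 ≤ n⁻¹ * n⁻¹ by positivity)
  refine add_le_add (this.trans (le_of_eq ?_)) le_rfl
  field_simp
  ring

end FiniteSampling

/-! ### Couplings that match classes. -/

section Coupling

/-- A coupling of the uniform law of `N` labels with the law `P` on `κ`, agreeing with the classes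
`c i` up to the total deviation. -/
lemma exists_finite_coupling {ι κ : Type*} [Fintype ι] [Nonempty ι] [Fintype κ] [DecidableEq κ]
    (c : ι → κ) (P : κ → ℝ) (hP : ∀ k, 0 ≤ P k) (hP1 : ∑ k, P k = 1) :
    ∃ J : ι → κ → ℝ, (∀ i k, 0 ≤ J i k) ∧ (∀ k, ∑ i, J i k = P k) ∧
      (∀ i, ∑ k, J i k = (Fintype.card ι : ℝ)⁻¹) ∧
      ∑ i, ∑ k, (if c i = k then 0 else J i k) ≤
        ∑ k, |(∑ i, (Fintype.card ι : ℝ)⁻¹ * if c i = k then (1 : ℝ) else 0) - P k| := by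
  set n : ℝ := (Fintype.card ι : ℝ) with hn
  have hn0 : 0 < n := by simp only [hn]; exact_mod_cast Fintype.card_pos
  set ν : κ → ℝ := fun k => ∑ i, n⁻¹ * if c i = k then (1 : ℝ) else 0 with hν
  have hν0 : ∀ k, 0 ≤ ν k := fun k => Finset.sum_nonneg fun i _ => by positivity
  have hνc : ∀ i, 0 < ν (c i) := fun i => by
    refine Finset.sum_pos' (fun j _ => by positivity) ⟨i, Finset.mem_univ i, ?_⟩
    simp [hn0]
  have hνsum : ∀ F : κ → ℝ, ∑ i, n⁻¹ * F (c i) = ∑ k, ν k * F k := by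
    intro F
    simp_rw [hν, Finset.sum_mul]
    rw [Finset.sum_comm]
    exact Finset.sum_congr rfl fun i _ => by simp
  have hν1 : ∑ k, ν k = 1 := by
    have := hνsum fun _ => 1
    simp only [mul_one, Finset.sum_const, Finset.card_univ, nsmul_eq_mul] at this
    rw [← this]; exact mul_inv_cancel₀ hn0.ne'
  set m : κ → ℝ := fun k => min (ν k) (P k) with hm
  have hm0 : ∀ k, 0 ≤ m k := fun k => le_min (hν0 k) (hP k)
  set τ : ℝ := ∑ k, (P k - m k) with hτ
  have hD0 : ∀ k, 0 ≤ P k - m k := fun k => sub_nonneg.2 (min_le_right _ _)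
  have hE0 : ∀ k, 0 ≤ ν k - m k := fun k => sub_nonneg.2 (min_le_left _ _)
  have hτ' : τ = ∑ k, (ν k - m k) := by
    simp only [hτ, Finset.sum_sub_distrib, hP1, hν1]
  have hτ0 : 0 ≤ τ := Finset.sum_nonneg fun k _ => hD0 k
  set A : ι → ℝ := fun i => n⁻¹ * ((ν (c i) - m (c i)) / ν (c i)) with hA
  have hA0 : ∀ i, 0 ≤ A i := fun i =>
    mul_nonneg (inv_nonneg.2 hn0.le) (div_nonneg (hE0 _) (hν0 _))
  have hAsum : ∑ i, A i = τ := by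
    rw [hA, hνsum fun k => (ν k - m k) / ν k, hτ']
    refine Finset.sum_congr rfl fun k _ => ?_
    by_cases h : ν k = 0
    · have : m k = 0 := le_antisymm (h ▸ min_le_left _ _) (hm0 k)
      simp [h, this]
    · field_simp
  -- The common mass `m = min ν P` stays within its class, shared equally by the labels of that
  -- class; the excess `A` of the labels is coupled to the deficit `P - m` by a product. Where `ν k`
  -- or `τ` vanishes the numerators vanish too, so the convention `x / 0 = 0` does no harm.
  refine ⟨fun i k => (if c i = k then n⁻¹ * (m k / ν k) else 0) + A i * ((P k - m k) / τ),
    fun i k => ?_, fun k => ?_, fun i => ?_, ?_⟩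
  · refine add_nonneg ?_ (mul_nonneg (hA0 i) (div_nonneg (hD0 k) hτ0))
    split_ifs
    · exact mul_nonneg (inv_nonneg.2 hn0.le) (div_nonneg (hm0 _) (hν0 _))
    · exact le_rfl
  · rw [Finset.sum_add_distrib, ← Finset.sum_mul, hAsum]
    have e1 : ∑ i, (if c i = k then n⁻¹ * (m k / ν k) else 0) = m k := by
      have : ∀ i, (if c i = k then n⁻¹ * (m k / ν k) else 0) =
          (n⁻¹ * if c i = k then (1 : ℝ) else 0) * (m k / ν k) := by
        intro i; split_ifs <;> simp
      simp_rw [this]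
      rw [← Finset.sum_mul]
      change ν k * (m k / ν k) = m k
      by_cases h : ν k = 0
      · have : m k = 0 := le_antisymm (h ▸ min_le_left _ _) (hm0 k)
        simp [h, this]
      · field_simp
    have e2 : τ * ((P k - m k) / τ) = P k - m k := by
      by_cases h : τ = 0
      · have := (Finset.sum_eq_zero_iff_of_nonneg fun k _ => hD0 k).1 h k (Finset.mem_univ k)
        simp [this]
      · field_simp
    rw [e1, e2]; ring
  · rw [Finset.sum_add_distrib, ← Finset.mul_sum, ← Finset.sum_div]
    have hv := (hνc i).ne'
    simp only [Finset.sum_ite_eq, Finset.mem_univ, if_true]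
    change n⁻¹ * (m (c i) / ν (c i)) + n⁻¹ * ((ν (c i) - m (c i)) / ν (c i)) * (τ / τ) = n⁻¹
    by_cases h : τ = 0
    · have h' := hτ'.symm.trans h
      have := (Finset.sum_eq_zero_iff_of_nonneg fun k _ => hE0 k).1 h' (c i) (Finset.mem_univ _)
      have : m (c i) = ν (c i) := by linarith
      rw [this]; simp [hv]
    · field_simp
      ring
  · have hle : ∑ i, ∑ k, (if c i = k then 0 else
        (if c i = k then n⁻¹ * (m k / ν k) else 0) + A i * ((P k - m k) / τ)) ≤ τ := by
      calc _ ≤ ∑ i, ∑ k, A i * ((P k - m k) / τ) := by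
            refine Finset.sum_le_sum fun i _ => Finset.sum_le_sum fun k _ => ?_
            split_ifs
            · exact mul_nonneg (hA0 i) (div_nonneg (hD0 k) hτ0)
            · simp
        _ = τ * (τ / τ) := by
            simp_rw [← Finset.mul_sum, ← Finset.sum_mul]
            rw [hAsum, ← Finset.sum_div]
        _ ≤ τ := mul_le_of_le_one_right hτ0 (div_self_le_one τ)
    refine hle.trans (Finset.sum_le_sum fun k _ => ?_)
    change P k - min (ν k) (P k) ≤ |ν k - P k|
    rcases le_total (ν k) (P k) with h | h
    · rw [min_eq_left h, abs_sub_comm]; exact le_abs_self _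
    · rw [min_eq_right h, sub_self]; exact abs_nonneg _

lemma uniformLabel_singleton {N : ℕ} (i : Fin N) :
    uniformLabel N {i} = (N : ℝ≥0∞)⁻¹ := by
  simp [uniformLabel]

instance isProbabilityMeasure_uniformLabel {N : ℕ} [NeZero N] :
    IsProbabilityMeasure (uniformLabel N) := by
  constructor
  simp [uniformLabel, Measure.count_univ]
  exact ENNReal.inv_mul_cancel (by simp [NeZero.ne N]) (by simp)

lemma lintegral_uniformLabel {N : ℕ} (h : Fin N → ℝ≥0∞) :
    ∫⁻ i, h i ∂(uniformLabel N) = (N : ℝ≥0∞)⁻¹ * ∑ i, h i := by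
  simp [uniformLabel, lintegral_count]

/-- A coupling of the uniform law on `[N]` with `π` under which the class `c i` of the label and
the class `G ζ` of the point agree up to the total deviation of their laws. -/
lemma exists_coupling {Ω : Type*} [MeasurableSpace Ω] (π : Measure Ω) [IsProbabilityMeasure π]
    {κ : Type*} [Fintype κ] [DecidableEq κ] [MeasurableSpace κ] [DiscreteMeasurableSpace κ]
    {N : ℕ} [NeZero N] (c : Fin N → κ) {G : Ω → κ} (hG : Measurable G) :
    ∃ μ : Measure (Fin N × Ω), MeasurePreserving Prod.fst μ (uniformLabel N) ∧
      MeasurePreserving Prod.snd μ π ∧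
      μ {z | c z.1 ≠ G z.2} ≤ ENNReal.ofReal
        (∑ k, |(∑ i, (N : ℝ)⁻¹ * if c i = k then (1 : ℝ) else 0) - π.real (G ⁻¹' {k})|) := by
  have hpre : ∀ k, MeasurableSet (G ⁻¹' {k}) := fun k => hG (measurableSet_singleton k)
  have hmap : ∀ k, (π.map G) {k} = ENNReal.ofReal (π.real (G ⁻¹' {k})) := fun k => by
    rw [Measure.map_apply hG (measurableSet_singleton k), ofReal_measureReal]
  have hlin : ∀ F : κ → ℝ≥0∞, ∫⁻ ζ, F (G ζ) ∂π =
      ∑ k, F k * ENNReal.ofReal (π.real (G ⁻¹' {k})) := fun F => by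
    rw [← lintegral_map (f := F) (by fun_prop) hG, lintegral_fintype]
    simp_rw [hmap]
  have hP1 : ∑ k, π.real (G ⁻¹' {k}) = 1 := by
    have := hlin fun _ => 1
    simp only [lintegral_const, measure_univ, one_mul] at this
    rw [← ENNReal.ofReal_sum_of_nonneg (fun k _ => measureReal_nonneg)] at this
    exact (ENNReal.ofReal_eq_one.1 this.symm)
  obtain ⟨J, hJ0, hJP, hJN, hJd⟩ := exists_finite_coupling c (fun k => π.real (G ⁻¹' {k}))
    (fun k => measureReal_nonneg) hP1
  simp only [Fintype.card_fin] at hJN hJd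
  have hJz : ∀ i k, π.real (G ⁻¹' {k}) = 0 → J i k = 0 := fun i k h => by
    have := hJP k
    rw [h] at this
    exact (Finset.sum_eq_zero_iff_of_nonneg fun i _ => hJ0 i k).1 this i (Finset.mem_univ i)
  -- The mass `J i k` is spread over the class `k` proportionally to `π`, so that `θ` is a density
  -- with respect to counting measure times `π`. On null classes `J` vanishes, by `hJz`.
  set θ : Fin N → κ → ℝ := fun i k => J i k / π.real (G ⁻¹' {k}) with hθ
  have hθ0 : ∀ i k, 0 ≤ θ i k := fun i k => div_nonneg (hJ0 i k) measureReal_nonneg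
  have hθP : ∀ i k, ENNReal.ofReal (θ i k) * ENNReal.ofReal (π.real (G ⁻¹' {k})) =
      ENNReal.ofReal (J i k) := fun i k => by
    rw [← ENNReal.ofReal_mul (hθ0 i k)]
    congr 1
    by_cases h : π.real (G ⁻¹' {k}) = 0
    · simp [h, hJz i k h]
    · simp only [hθ]; field_simp
  have hdens : Measurable fun z : Fin N × Ω => ENNReal.ofReal (θ z.1 (G z.2)) :=
    (Measurable.of_discrete (f := fun q : Fin N × κ => ENNReal.ofReal (θ q.1 q.2))).comp
      (measurable_fst.prodMk (hG.comp measurable_snd))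
  set μ : Measure (Fin N × Ω) :=
    ((Measure.count : Measure (Fin N)).prod π).withDensity
      (fun z => ENNReal.ofReal (θ z.1 (G z.2))) with hμ
  have hμA : ∀ s : Set (Fin N × Ω), MeasurableSet s → μ s =
      ∑ i, ∫⁻ ζ, s.indicator (fun z => ENNReal.ofReal (θ z.1 (G z.2))) (i, ζ) ∂π := by
    intro s hs
    rw [hμ, withDensity_apply _ hs, ← lintegral_indicator hs,
      lintegral_prod _ (hdens.indicator hs).aemeasurable, lintegral_count, tsum_fintype]
  refine ⟨μ, ⟨measurable_fst, ?_⟩, ⟨measurable_snd, ?_⟩, ?_⟩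
  · refine Measure.ext_of_singleton fun i => ?_
    rw [Measure.map_apply measurable_fst (measurableSet_singleton i),
      hμA _ (measurable_fst (measurableSet_singleton i)), uniformLabel_singleton,
      Finset.sum_eq_single i]
    · have : ∀ ζ, (Prod.fst ⁻¹' {i} : Set (Fin N × Ω)).indicator
          (fun z => ENNReal.ofReal (θ z.1 (G z.2))) (i, ζ) = ENNReal.ofReal (θ i (G ζ)) :=
        fun ζ => by simp
      simp_rw [this]
      rw [hlin fun k => ENNReal.ofReal (θ i k)]
      simp_rw [hθP]
      rw [← ENNReal.ofReal_sum_of_nonneg fun k _ => hJ0 i k, hJN,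
        ENNReal.ofReal_inv_of_pos (by exact_mod_cast NeZero.pos N), ENNReal.ofReal_natCast]
    · intro j _ hj; simp [hj]
    · simp
  · refine Measure.ext fun T hT => ?_
    rw [Measure.map_apply measurable_snd hT, hμA _ (measurable_snd hT)]
    have h1 : ∀ i, ∫⁻ ζ, (Prod.snd ⁻¹' T : Set (Fin N × Ω)).indicator
        (fun z => ENNReal.ofReal (θ z.1 (G z.2))) (i, ζ) ∂π =
        ∫⁻ ζ in T, ENNReal.ofReal (θ i (G ζ)) ∂π := fun i => by
      rw [← lintegral_indicator hT]; rfl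
    simp_rw [h1]
    rw [← lintegral_finsetSum _ fun i _ => ?_]
    · have h0 : ∀ k, π.real (G ⁻¹' {k}) = 0 → ∀ᵐ ζ ∂π, G ζ ≠ k := fun k hk => by
        rw [ae_iff]
        simp only [ne_eq, not_not]
        exact (measureReal_eq_zero_iff).1 hk
      have hone : ∀ᵐ ζ ∂π, ∑ i, ENNReal.ofReal (θ i (G ζ)) = 1 := by
        have : ∀ᵐ ζ ∂π, ∀ k, π.real (G ⁻¹' {k}) = 0 → G ζ ≠ k := by
          rw [ae_all_iff]
          intro k
          by_cases hk : π.real (G ⁻¹' {k}) = 0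
          · filter_upwards [h0 k hk] with ζ hζ _ using hζ
          · exact Filter.Eventually.of_forall fun ζ h => absurd h hk
        filter_upwards [this] with ζ hζ
        have hne : π.real (G ⁻¹' {G ζ}) ≠ 0 := fun h => hζ _ h rfl
        rw [← ENNReal.ofReal_sum_of_nonneg fun i _ => hθ0 i _]
        simp only [hθ]
        rw [← Finset.sum_div, hJP, div_self hne, ENNReal.ofReal_one]
      rw [setLIntegral_congr_fun_ae hT (hone.mono fun ζ h _ => h)]
      simp
    · exact ((Measurable.of_discrete (f := fun k : κ => ENNReal.ofReal (θ i k))).comp hG)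
  · have hs : MeasurableSet {z : Fin N × Ω | c z.1 ≠ G z.2} :=
      (measurableSet_eq_fun ((Measurable.of_discrete (f := c)).comp measurable_fst)
        (hG.comp measurable_snd)).compl
    rw [hμA _ hs]
    refine le_trans (le_of_eq ?_) (ENNReal.ofReal_le_ofReal hJd)
    have hite : ∀ i k, 0 ≤ (if c i = k then 0 else J i k) := fun i k => by
      split_ifs
      · exact le_rfl
      · exact hJ0 i k
    rw [ENNReal.ofReal_sum_of_nonneg fun i _ => Finset.sum_nonneg fun k _ => hite i k]
    refine Finset.sum_congr rfl fun i _ => ?_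
    rw [ENNReal.ofReal_sum_of_nonneg fun k _ => hite i k]
    have : ∀ ζ, {z : Fin N × Ω | c z.1 ≠ G z.2}.indicator
        (fun z => ENNReal.ofReal (θ z.1 (G z.2))) (i, ζ) =
        (fun k => if c i = k then 0 else ENNReal.ofReal (θ i k)) (G ζ) := fun ζ => by
      by_cases h : c i = G ζ <;> simp [Set.indicator, h]
    simp_rw [this]
    rw [hlin (fun k => if c i = k then 0 else ENNReal.ofReal (θ i k))]
    refine Finset.sum_congr rfl fun k _ => ?_
    split_ifs with h
    · simp
    · exact hθP i k

end Coupling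

/-! ### The cut norm and its comparison with the sign norm. -/

section CutNorm

variable {Ω : Type*} [MeasurableSpace Ω] {μ : Measure Ω}

lemma cutNorm_le_lintegral (w : Ω → Ω → ℝ) :
    cutNorm μ w ≤ ∫⁻ p, ‖w p.1 p.2‖ₑ ∂(μ.prod μ) := by
  refine iSup_le fun S => iSup_le fun T => iSup_le fun _ => iSup_le fun _ => ?_
  rw [← Real.enorm_eq_ofReal_abs]
  exact (enorm_integral_le_lintegral_enorm _).trans (setLIntegral_le_lintegral _ _)

lemma cutNorm_add_le {v w : Ω → Ω → ℝ}
    (hv : Integrable (fun p : Ω × Ω => v p.1 p.2) (μ.prod μ))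
    (hw : Integrable (fun p : Ω × Ω => w p.1 p.2) (μ.prod μ)) :
    cutNorm μ (fun x y => v x y + w x y) ≤ cutNorm μ v + cutNorm μ w := by
  refine iSup_le fun S => iSup_le fun T => iSup_le fun hS => iSup_le fun hT => ?_
  rw [integral_add hv.integrableOn hw.integrableOn]
  refine (ENNReal.ofReal_le_ofReal (abs_add_le _ _)).trans ?_
  rw [ENNReal.ofReal_add (abs_nonneg _) (abs_nonneg _)]
  refine add_le_add ?_ ?_
  · exact le_iSup_of_le S (le_iSup_of_le T (le_iSup_of_le hS (le_iSup_of_le hT le_rfl)))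
  · exact le_iSup_of_le S (le_iSup_of_le T (le_iSup_of_le hS (le_iSup_of_le hT le_rfl)))

/-- The cut norm of a kernel that depends on finitely many classes is at most the sign norm of the
weighted matrix. -/
lemma cutNorm_comp_le [IsProbabilityMeasure μ] {β : Type*} [Fintype β] [MeasurableSpace β]
    [DiscreteMeasurableSpace β] {φ : Ω → β} (hφ : Measurable φ) (V : β → β → ℝ) :
    cutNorm μ (fun x y => V (φ x) (φ y)) ≤
      ENNReal.ofReal (signNorm fun a b =>
        μ.real (φ ⁻¹' {a}) * μ.real (φ ⁻¹' {b}) * V a b) := by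
  refine iSup_le fun S => iSup_le fun T => iSup_le fun hS => iSup_le fun hT =>
    ENNReal.ofReal_le_ofReal ?_
  have hpre : ∀ a, MeasurableSet (φ ⁻¹' {a}) := fun a => hφ (measurableSet_singleton a)
  have hint : ∫ p in S ×ˢ T, V (φ p.1) (φ p.2) ∂(μ.prod μ) =
      ∑ a, ∑ b, μ.real (φ ⁻¹' {a} ∩ S) * μ.real (φ ⁻¹' {b} ∩ T) * V a b := by
    have hm : Measurable (Prod.map φ φ) := hφ.prodMap hφ
    have : ∫ p in S ×ˢ T, V (φ p.1) (φ p.2) ∂(μ.prod μ) =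
        ∫ q, V q.1 q.2 ∂(((μ.prod μ).restrict (S ×ˢ T)).map (Prod.map φ φ)) := by
      rw [integral_map hm.aemeasurable
        (Measurable.of_discrete (f := fun q : β × β => V q.1 q.2)).aestronglyMeasurable]
      rfl
    rw [this, integral_fintype Integrable.of_finite, Fintype.sum_prod_type]
    refine Finset.sum_congr rfl fun a _ => Finset.sum_congr rfl fun b _ => ?_
    rw [map_measureReal_apply hm (measurableSet_singleton _), smul_eq_mul]
    congr 1
    have hset : Prod.map φ φ ⁻¹' {(a, b)} = (φ ⁻¹' {a}) ×ˢ (φ ⁻¹' {b}) := by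
      ext ⟨x, y⟩; simp
    rw [hset, measureReal_restrict_apply ((hpre a).prod (hpre b)), Set.prod_inter_prod,
      measureReal_prod_prod]
  rw [hint]
  -- The sets `S` and `T` enter only through the fraction of each class that they occupy; these
  -- fractions are test weights in `[0, 1]`.
  have hratio : ∀ (U : Set Ω) (a : β),
      |μ.real (φ ⁻¹' {a} ∩ U) / μ.real (φ ⁻¹' {a})| ≤ 1 := fun U a => by
    rw [abs_of_nonneg (div_nonneg measureReal_nonneg measureReal_nonneg)]
    exact div_le_one_of_le₀ (measureReal_mono Set.inter_subset_left) measureReal_nonneg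
  have hmul : ∀ (U : Set Ω) (a : β), μ.real (φ ⁻¹' {a} ∩ U) / μ.real (φ ⁻¹' {a}) *
      μ.real (φ ⁻¹' {a}) = μ.real (φ ⁻¹' {a} ∩ U) := fun U a => by
    by_cases h : μ.real (φ ⁻¹' {a}) = 0
    · rw [h, mul_zero]
      exact (le_antisymm ((measureReal_mono Set.inter_subset_left).trans_eq h)
        measureReal_nonneg).symm
    · exact div_mul_cancel₀ _ h
  refine le_trans (le_of_eq ?_) (abs_sum_mul_le_signNorm _ (hratio S) (hratio T))
  congr 1
  refine Finset.sum_congr rfl fun a _ => Finset.sum_congr rfl fun b _ => ?_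
  linear_combination (-V a b * μ.real (φ ⁻¹' {b} ∩ T)) * hmul S a -
    (V a b * (μ.real (φ ⁻¹' {a} ∩ S) / μ.real (φ ⁻¹' {a}) * μ.real (φ ⁻¹' {a}))) * hmul T b

end CutNorm

lemma lintegral_enorm_add_le {Ω E : Type*} [MeasurableSpace Ω] {μ : Measure Ω}
    [NormedAddCommGroup E] {f g : Ω → E} (hf : AEStronglyMeasurable f μ) :
    ∫⁻ x, ‖f x + g x‖ₑ ∂μ ≤ ∫⁻ x, ‖f x‖ₑ ∂μ + ∫⁻ x, ‖g x‖ₑ ∂μ := by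
  rw [← lintegral_add_left' hf.enorm]
  exact lintegral_mono fun x => enorm_add_le _ _

lemma MeasureTheory.MeasurePreserving.lintegral_comp_ae {Ω Ω' : Type*} [MeasurableSpace Ω]
    [MeasurableSpace Ω'] {μ : Measure Ω} {π : Measure Ω'} {φ : Ω → Ω'}
    (hφ : MeasurePreserving φ μ π) {f : Ω' → ℝ≥0∞} (hf : AEMeasurable f π) :
    ∫⁻ x, f (φ x) ∂μ = ∫⁻ y, f y ∂π := by
  rw [← hφ.map_eq] at hf ⊢
  exact (lintegral_map' hf hφ.measurable.aemeasurable).symm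

/-! ### The deterministic bound on the distance. -/

section SamplingDist

lemma unlabeledDist_le.{r, s, t} {D : Type t} [NormedAddCommGroup D]
    {Ω₁ : Type r} [MeasurableSpace Ω₁] {Ω₂ : Type s} [MeasurableSpace Ω₂]
    (X₁ : Ω₁ → D) (w₁ : Ω₁ → Ω₁ → ℝ) {π₁ : Measure Ω₁}
    (X₂ : Ω₂ → D) (w₂ : Ω₂ → Ω₂ → ℝ) {π₂ : Measure Ω₂}
    {Ω : Type (max r s)} [m : MeasurableSpace Ω] [b : StandardBorelSpace Ω] {μ : Measure Ω}
    [p : IsProbabilityMeasure μ] {φ₁ : Ω → Ω₁} {φ₂ : Ω → Ω₂} (h₁ : MeasurePreserving φ₁ μ π₁)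
    (h₂ : MeasurePreserving φ₂ μ π₂) :
    unlabeledDist X₁ w₁ π₁ X₂ w₂ π₂ ≤ eLpNorm (fun ξ => X₁ (φ₁ ξ) - X₂ (φ₂ ξ)) 1 μ +
      cutNorm μ (fun ξ ζ => w₁ (φ₁ ξ) (φ₁ ζ) - w₂ (φ₂ ξ) (φ₂ ζ)) :=
  iInf_le_of_le Ω <| iInf_le_of_le m <| iInf_le_of_le b <| iInf_le_of_le μ <|
    iInf_le_of_le p <| iInf_le_of_le φ₁ <| iInf_le_of_le φ₂ <| iInf_le_of_le h₁ <|
    iInf_le_of_le h₂ le_rfl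

/-- A deterministic bound for the distance between a triplet and its sampling, through a state
function and a kernel that factor through finitely many classes. -/
lemma samplingDist_le {D : Type*} [NormedAddCommGroup D] {Ω : Type u} [MeasurableSpace Ω]
    [StandardBorelSpace Ω] (π : Measure Ω) [IsProbabilityMeasure π] {X : Ω → D} {w : Ω → Ω → ℝ}
    (hX : AEStronglyMeasurable X π)
    (hw : Integrable (fun p : Ω × Ω => w p.1 p.2) (π.prod π))
    {α κ : Type*} [Fintype α] [MeasurableSpace α] [DiscreteMeasurableSpace α] [Fintype κ]
    [DecidableEq κ] {f : Ω → α} (hf : Measurable f) (g : α → κ) (x : κ → D) (W : α → α → ℝ)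
    (u : κ → κ → ℝ) {R M : ℝ} (hR : ∀ k, ‖x k‖ ≤ R) (hM : ∀ k l, |u k l| ≤ M)
    {N : ℕ} [NeZero N] (ξ : Fin N → Ω) :
    samplingDist X w π ξ ≤
      ((N : ℝ≥0∞)⁻¹ * ∑ i, ‖X (ξ i) - x (g (f (ξ i)))‖ₑ + ∫⁻ ζ, ‖X ζ - x (g (f ζ))‖ₑ ∂π) +
      ((N : ℝ≥0∞)⁻¹ * ∑ i, (N : ℝ≥0∞)⁻¹ * ∑ j, ‖w (ξ i) (ξ j) - W (f (ξ i)) (f (ξ j))‖ₑ +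
        ∫⁻ p, ‖w p.1 p.2 - W (f p.1) (f p.2)‖ₑ ∂(π.prod π)) +
      (ENNReal.ofReal (signNorm fun i j => (N : ℝ)⁻¹ * (N : ℝ)⁻¹ *
          (W (f (ξ i)) (f (ξ j)) - u (g (f (ξ i))) (g (f (ξ j))))) +
        ENNReal.ofReal (signNorm fun a b => π.real (f ⁻¹' {a}) * π.real (f ⁻¹' {b}) *
          (W a b - u (g a) (g b)))) +
      ENNReal.ofReal ((2 * R + 4 * M) *
        ∑ k, |(∑ i, (N : ℝ)⁻¹ * if g (f (ξ i)) = k then (1 : ℝ) else 0) -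
          π.real ((fun ζ => g (f ζ)) ⁻¹' {k})|) := by
  let _ : MeasurableSpace κ := ⊤
  have hG : Measurable fun ζ => g (f ζ) := (Measurable.of_discrete (f := g)).comp hf
  obtain ⟨μ, h1, h2, hd⟩ := exists_coupling π (fun i => g (f (ξ i))) hG
  set δ : ℝ := ∑ k, |(∑ i, (N : ℝ)⁻¹ * if g (f (ξ i)) = k then (1 : ℝ) else 0) -
          π.real ((fun ζ => g (f ζ)) ⁻¹' {k})| with hδ
  have : IsProbabilityMeasure μ := by
    constructor
    rw [← Set.preimage_univ (f := Prod.fst), h1.measure_preimage MeasurableSet.univ.nullMeasurableSet]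
    exact measure_univ
  obtain ⟨k₀⟩ : Nonempty κ := ⟨g (f (ξ 0))⟩
  have hR0 : 0 ≤ R := (norm_nonneg _).trans (hR k₀)
  have hM0 : 0 ≤ M := (abs_nonneg _).trans (hM k₀ k₀)
  have hδ0 : 0 ≤ δ := Finset.sum_nonneg fun k _ => abs_nonneg _
  set E : Set (Fin N × Ω) := {z | g (f (ξ z.1)) ≠ g (f z.2)} with hE
  have hEm : MeasurableSet E :=
    (measurableSet_eq_fun
      ((Measurable.of_discrete (f := fun i => g (f (ξ i)))).comp measurable_fst)
      (hG.comp measurable_snd)).compl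
  have h11 := h1.prod h1
  have h22 := h2.prod h2
  refine (unlabeledDist_le _ _ _ _ h1 h2).trans ?_
  have hstate : eLpNorm (fun z : Fin N × Ω => X (ξ z.1) - X z.2) 1 μ ≤
      ((N : ℝ≥0∞)⁻¹ * ∑ i, ‖X (ξ i) - x (g (f (ξ i)))‖ₑ + ∫⁻ ζ, ‖X ζ - x (g (f ζ))‖ₑ ∂π) +
        ENNReal.ofReal (2 * R * δ) := by
    rw [eLpNorm_one_eq_lintegral_enorm]
    have hxs : AEStronglyMeasurable (fun ζ => X ζ - x (g (f ζ))) π :=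
      hX.sub ((StronglyMeasurable.of_discrete (f := x)).comp_measurable hG).aestronglyMeasurable
    have m1 : AEStronglyMeasurable (fun z : Fin N × Ω => X (ξ z.1) - x (g (f (ξ z.1)))) μ :=
      ((StronglyMeasurable.of_discrete (f := fun i : Fin N => X (ξ i) - x (g (f (ξ i))))).comp_measurable
        measurable_fst).aestronglyMeasurable
    have m2 : AEStronglyMeasurable (fun z : Fin N × Ω => -(X z.2 - x (g (f z.2)))) μ :=
      (hxs.comp_measurePreserving h2).neg
    have e : ∀ z : Fin N × Ω, X (ξ z.1) - X z.2 = (X (ξ z.1) - x (g (f (ξ z.1)))) +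
        (-(X z.2 - x (g (f z.2))) + (x (g (f (ξ z.1))) - x (g (f z.2)))) := fun z => by abel
    simp_rw [e]
    refine (lintegral_enorm_add_le m1).trans ?_
    rw [add_assoc]
    refine add_le_add (le_of_eq ?_) ((lintegral_enorm_add_le m2).trans (add_le_add ?_ ?_))
    · rw [← lintegral_uniformLabel]
      exact h1.lintegral_comp_ae (f := fun i => ‖X (ξ i) - x (g (f (ξ i)))‖ₑ) (by fun_prop)
    · simp_rw [enorm_neg]
      exact (h2.lintegral_comp_ae hxs.enorm).le
    · calc _ ≤ ∫⁻ z, E.indicator (fun _ => ENNReal.ofReal (2 * R)) z ∂μ := by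
            refine lintegral_mono fun z => ?_
            by_cases hz : z ∈ E
            · rw [Set.indicator_of_mem hz, ← ofReal_norm]
              refine ENNReal.ofReal_le_ofReal ((norm_sub_le _ _).trans ?_)
              linarith [hR (g (f (ξ z.1))), hR (g (f z.2))]
            · have : g (f (ξ z.1)) = g (f z.2) := by simpa [hE] using hz
              simp [this]
        _ = ENNReal.ofReal (2 * R) * μ E := by rw [lintegral_indicator_const hEm]
        _ ≤ ENNReal.ofReal (2 * R) * ENNReal.ofReal δ := mul_le_mul_right hd _
        _ = _ := (ENNReal.ofReal_mul (by positivity)).symm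
  have hweight : cutNorm μ (fun y z : Fin N × Ω => w (ξ y.1) (ξ z.1) - w y.2 z.2) ≤
      ((N : ℝ≥0∞)⁻¹ * ∑ i, (N : ℝ≥0∞)⁻¹ * ∑ j, ‖w (ξ i) (ξ j) - W (f (ξ i)) (f (ξ j))‖ₑ +
        ∫⁻ p, ‖w p.1 p.2 - W (f p.1) (f p.2)‖ₑ ∂(π.prod π)) +
      (ENNReal.ofReal (signNorm fun i j => (N : ℝ)⁻¹ * (N : ℝ)⁻¹ *
          (W (f (ξ i)) (f (ξ j)) - u (g (f (ξ i))) (g (f (ξ j))))) +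
        ENNReal.ofReal (signNorm fun a b => π.real (f ⁻¹' {a}) * π.real (f ⁻¹' {b}) *
          (W a b - u (g a) (g b)))) + ENNReal.ofReal (4 * M * δ) := by
    have ilab : ∀ h : Fin N → Fin N → ℝ,
        Integrable (fun p : (Fin N × Ω) × (Fin N × Ω) => h p.1.1 p.2.1) (μ.prod μ) := fun h =>
      h11.integrable_comp_of_integrable
        (Integrable.of_finite : Integrable (fun q : Fin N × Fin N => h q.1 q.2) _)
    have ipt : ∀ h : α → α → ℝ, Integrable (fun p : Ω × Ω => h (f p.1) (f p.2)) (π.prod π) :=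
      fun h => by
        have hm : Measurable (Prod.map f f) := hf.prodMap hf
        exact (Integrable.of_finite : Integrable (fun q : α × α => h q.1 q.2)
          ((π.prod π).map (Prod.map f f))).comp_measurable hm
    have ipt' : ∀ h : α → α → ℝ, Integrable
        (fun p : (Fin N × Ω) × (Fin N × Ω) => h (f p.1.2) (f p.2.2)) (μ.prod μ) := fun h =>
      h22.integrable_comp_of_integrable (ipt h)
    have iw : Integrable (fun p : Ω × Ω => W (f p.1) (f p.2) - w p.1 p.2) (π.prod π) :=
      (ipt W).sub hw
    have iw' : Integrable (fun p : (Fin N × Ω) × (Fin N × Ω) =>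
        W (f p.1.2) (f p.2.2) - w p.1.2 p.2.2) (μ.prod μ) :=
      h22.integrable_comp_of_integrable iw
    have i1 := ilab fun i j => w (ξ i) (ξ j) - W (f (ξ i)) (f (ξ j))
    have i2 := ilab fun i j => W (f (ξ i)) (f (ξ j)) - u (g (f (ξ i))) (g (f (ξ j)))
    have i3 : Integrable (fun p : (Fin N × Ω) × (Fin N × Ω) =>
        u (g (f (ξ p.1.1))) (g (f (ξ p.2.1))) - u (g (f p.1.2)) (g (f p.2.2))) (μ.prod μ) :=
      (ilab fun i j => u (g (f (ξ i))) (g (f (ξ j)))).sub (ipt' fun a b => u (g a) (g b))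
    have i4 := ipt' fun a b => -(W a b - u (g a) (g b))
    -- The two approximation errors by `W` are measured in `L¹`, and the two copies of `W - u` in
    -- sign norm. The last difference vanishes unless `y` or `z` lies in the mismatch set `E`; it is
    -- at most `2 M`, and each of the two events has probability at most `δ`, which gives `4 M δ`.
    have e : (fun y z : Fin N × Ω => w (ξ y.1) (ξ z.1) - w y.2 z.2) = fun y z =>
        (w (ξ y.1) (ξ z.1) - W (f (ξ y.1)) (f (ξ z.1))) + ((W (f y.2) (f z.2) - w y.2 z.2) +
        ((W (f (ξ y.1)) (f (ξ z.1)) - u (g (f (ξ y.1))) (g (f (ξ z.1)))) +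
        (-(W (f y.2) (f z.2) - u (g (f y.2)) (g (f z.2))) +
        (u (g (f (ξ y.1))) (g (f (ξ z.1))) - u (g (f y.2)) (g (f z.2)))))) := by
      ext y z; ring
    rw [e]
    refine (cutNorm_add_le i1 (iw'.add (i2.add (i4.add i3)))).trans ?_
    refine (add_le_add le_rfl (cutNorm_add_le iw' (i2.add (i4.add i3)))).trans ?_
    refine (add_le_add le_rfl (add_le_add le_rfl (cutNorm_add_le i2 (i4.add i3)))).trans ?_
    refine (add_le_add le_rfl (add_le_add le_rfl (add_le_add le_rfl
      (cutNorm_add_le i4 i3)))).trans ?_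
    rw [← add_assoc, ← add_assoc (cutNorm μ _) (cutNorm μ _) (cutNorm μ _), ← add_assoc]
    refine add_le_add (add_le_add (add_le_add ?_ ?_) (add_le_add ?_ ?_)) ?_
    · refine (cutNorm_le_lintegral _).trans (le_of_eq ?_)
      have := h11.lintegral_comp_ae
        (f := fun q : Fin N × Fin N => ‖w (ξ q.1) (ξ q.2) - W (f (ξ q.1)) (f (ξ q.2))‖ₑ)
        (by fun_prop)
      refine this.trans ?_
      rw [lintegral_prod _ (by fun_prop), lintegral_uniformLabel]
      simp_rw [lintegral_uniformLabel]
    · refine (cutNorm_le_lintegral _).trans (le_of_eq ?_)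
      refine (h22.lintegral_comp_ae (f := fun p : Ω × Ω =>
        ‖W (f p.1) (f p.2) - w p.1 p.2‖ₑ) iw.aestronglyMeasurable.enorm).trans ?_
      exact lintegral_congr fun p => enorm_sub_rev _ _
    · refine (cutNorm_comp_le measurable_fst
        (fun i j => W (f (ξ i)) (f (ξ j)) - u (g (f (ξ i))) (g (f (ξ j))))).trans (le_of_eq ?_)
      have : ∀ i : Fin N, μ.real (Prod.fst ⁻¹' {i}) = (N : ℝ)⁻¹ := fun i => by
        rw [measureReal_def, h1.measure_preimage (measurableSet_singleton i).nullMeasurableSet,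
          uniformLabel_singleton]
        simp
      simp_rw [this]
    · refine (cutNorm_comp_le (hf.comp measurable_snd)
        (fun a b => -(W a b - u (g a) (g b)))).trans (ENNReal.ofReal_le_ofReal ?_)
      have : ∀ a, μ.real (f ∘ Prod.snd ⁻¹' {a}) = π.real (f ⁻¹' {a}) := fun a => by
        rw [measureReal_def, measureReal_def, Set.preimage_comp,
          h2.measure_preimage (hf (measurableSet_singleton a)).nullMeasurableSet]
      simp_rw [this]
      refine signNorm_le fun s t => ?_
      refine le_trans (le_of_eq ?_) (sum_sgn_le_signNorm _ (fun a => -s a) t)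
      refine Finset.sum_congr rfl fun a _ => Finset.sum_congr rfl fun b _ => ?_
      rw [sgn_neg]; ring
    · refine (cutNorm_le_lintegral _).trans ?_
      calc _ ≤ ∫⁻ p : (Fin N × Ω) × (Fin N × Ω),
            ((Prod.fst ⁻¹' E).indicator (fun _ => ENNReal.ofReal (2 * M)) p +
              (Prod.snd ⁻¹' E).indicator (fun _ => ENNReal.ofReal (2 * M)) p) ∂(μ.prod μ) := by
            refine lintegral_mono fun p => ?_
            have hb : ‖u (g (f (ξ p.1.1))) (g (f (ξ p.2.1))) -
                u (g (f p.1.2)) (g (f p.2.2))‖ₑ ≤ ENNReal.ofReal (2 * M) := by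
              rw [← ofReal_norm]
              refine ENNReal.ofReal_le_ofReal ((norm_sub_le _ _).trans ?_)
              rw [Real.norm_eq_abs, Real.norm_eq_abs]
              linarith [hM (g (f (ξ p.1.1))) (g (f (ξ p.2.1))), hM (g (f p.1.2)) (g (f p.2.2))]
            by_cases hp : p.1 ∈ E
            · rw [Set.indicator_of_mem (show p ∈ Prod.fst ⁻¹' E from hp)]
              exact hb.trans le_self_add
            · by_cases hq : p.2 ∈ E
              · rw [Set.indicator_of_mem (show p ∈ Prod.snd ⁻¹' E from hq)]
                exact hb.trans le_add_self
              · have e1 : g (f (ξ p.1.1)) = g (f p.1.2) := by simpa [hE] using hp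
                have e2 : g (f (ξ p.2.1)) = g (f p.2.2) := by simpa [hE] using hq
                simp [e1, e2]
        _ = ENNReal.ofReal (2 * M) * μ E + ENNReal.ofReal (2 * M) * μ E := by
            rw [lintegral_add_left (measurable_const.indicator (measurable_fst hEm)),
              lintegral_indicator_const (measurable_fst hEm),
              lintegral_indicator_const (measurable_snd hEm),
              measurePreserving_fst.measure_preimage hEm.nullMeasurableSet,
              measurePreserving_snd.measure_preimage hEm.nullMeasurableSet]
        _ ≤ ENNReal.ofReal (2 * M) * ENNReal.ofReal δ +
              ENNReal.ofReal (2 * M) * ENNReal.ofReal δ :=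
            add_le_add (mul_le_mul_right hd _) (mul_le_mul_right hd _)
        _ = _ := by
            rw [← ENNReal.ofReal_mul (by positivity), ← ENNReal.ofReal_add (by positivity)
              (by positivity)]
            congr 1; ring
  refine (add_le_add hstate hweight).trans (le_of_eq ?_)
  rw [show (2 * R + 4 * M) * δ = 2 * R * δ + 4 * M * δ by ring,
    ENNReal.ofReal_add (by positivity) (by positivity)]
  ring

end SamplingDist

/-! ### Measurability of the sampled distance. -/

section Measurability

/-- A finite sum of one-coordinate functions; no separability of `E` is needed. -/
lemma aestronglyMeasurable_pi_of_eval {Ω ι E : Type*} [MeasurableSpace Ω] {μ : Measure Ω}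
    [Fintype ι] [NormedAddCommGroup E] {F : Ω → ι → E}
    (hF : ∀ i, AEStronglyMeasurable (fun x => F x i) μ) : AEStronglyMeasurable F μ := by
  classical
  have e : F = fun x => ∑ i, Pi.single i (F x i) := by
    ext x : 1
    exact (Finset.univ_sum_single (F x)).symm
  rw [e]
  exact Finset.aestronglyMeasurable_fun_sum _ fun i _ =>
    (continuous_single (A := fun _ : ι => E) i).comp_aestronglyMeasurable (hF i)

/-- The unlabeled distance depends on the finite triplet in a Lipschitz way. -/
lemma unlabeledDist_le_add_edist {D : Type*} [NormedAddCommGroup D] {Ω : Type u}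
    [MeasurableSpace Ω] (π : Measure Ω) [IsProbabilityMeasure π] {X : Ω → D} {w : Ω → Ω → ℝ}
    (hX : AEStronglyMeasurable X π)
    (hw : Integrable (fun p : Ω × Ω => w p.1 p.2) (π.prod π)) {N : ℕ} [NeZero N]
    (y y' : (Fin N → D) × (Fin N → Fin N → ℝ)) :
    unlabeledDist y.1 y.2 (uniformLabel N) X w π ≤
      unlabeledDist y'.1 y'.2 (uniformLabel N) X w π + 2 * edist y y' := by
  conv_rhs => rw [unlabeledDist]
  simp only [ENNReal.iInf_add]
  refine le_iInf fun Ω' => le_iInf fun m => le_iInf fun b => le_iInf fun μ => le_iInf fun p =>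
    le_iInf fun φ₁ => le_iInf fun φ₂ => le_iInf fun h₁ => le_iInf fun h₂ => ?_
  refine (unlabeledDist_le _ _ _ _ h₁ h₂).trans ?_
  have hst : eLpNorm (fun ξ => y.1 (φ₁ ξ) - X (φ₂ ξ)) 1 μ ≤
      eLpNorm (fun ξ => y'.1 (φ₁ ξ) - X (φ₂ ξ)) 1 μ + edist y y' := by
    have m1 : AEStronglyMeasurable (fun ξ => y'.1 (φ₁ ξ) - X (φ₂ ξ)) μ :=
      ((StronglyMeasurable.of_discrete (f := y'.1)).comp_measurable
        h₁.measurable).aestronglyMeasurable.sub (hX.comp_measurePreserving h₂)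
    rw [eLpNorm_one_eq_lintegral_enorm, eLpNorm_one_eq_lintegral_enorm]
    have e : ∀ ξ, y.1 (φ₁ ξ) - X (φ₂ ξ) =
        (y'.1 (φ₁ ξ) - X (φ₂ ξ)) + (y.1 (φ₁ ξ) - y'.1 (φ₁ ξ)) := fun ξ => by abel
    simp_rw [e]
    refine (lintegral_enorm_add_le m1).trans (add_le_add le_rfl ?_)
    calc _ ≤ ∫⁻ _, edist y y' ∂μ := by
          refine lintegral_mono fun ξ => ?_
          rw [← edist_eq_enorm_sub]
          exact (edist_le_pi_edist _ _ _).trans (le_max_left _ _)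
      _ = _ := by simp
  have hwt : cutNorm μ (fun ξ ζ => y.2 (φ₁ ξ) (φ₁ ζ) - w (φ₂ ξ) (φ₂ ζ)) ≤
      cutNorm μ (fun ξ ζ => y'.2 (φ₁ ξ) (φ₁ ζ) - w (φ₂ ξ) (φ₂ ζ)) + edist y y' := by
    have ilab : ∀ h : Fin N → Fin N → ℝ,
        Integrable (fun p : Ω' × Ω' => h (φ₁ p.1) (φ₁ p.2)) (μ.prod μ) := fun h =>
      (h₁.prod h₁).integrable_comp_of_integrable
        (Integrable.of_finite : Integrable (fun q : Fin N × Fin N => h q.1 q.2) _)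
    have iw : Integrable (fun p : Ω' × Ω' => w (φ₂ p.1) (φ₂ p.2)) (μ.prod μ) :=
      (h₂.prod h₂).integrable_comp_of_integrable hw
    have e : (fun ξ ζ => y.2 (φ₁ ξ) (φ₁ ζ) - w (φ₂ ξ) (φ₂ ζ)) = fun ξ ζ =>
        (y'.2 (φ₁ ξ) (φ₁ ζ) - w (φ₂ ξ) (φ₂ ζ)) + (y.2 (φ₁ ξ) (φ₁ ζ) - y'.2 (φ₁ ξ) (φ₁ ζ)) := by
      ext ξ ζ; ring
    rw [e]
    refine (cutNorm_add_le ((ilab y'.2).sub iw)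
      (ilab fun i j => y.2 i j - y'.2 i j)).trans (add_le_add le_rfl ?_)
    refine (cutNorm_le_lintegral _).trans ?_
    calc _ ≤ ∫⁻ _, edist y y' ∂(μ.prod μ) := by
          refine lintegral_mono fun ξ => ?_
          rw [← edist_eq_enorm_sub]
          exact (edist_le_pi_edist (y.2 _) (y'.2 _) _).trans
            ((edist_le_pi_edist y.2 y'.2 _).trans (le_max_right _ _))
      _ = _ := by simp
  refine (add_le_add hst hwt).trans (le_of_eq ?_)
  ring

lemma measurePreserving_eval_pair {Ω : Type*} [MeasurableSpace Ω] {N : ℕ}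
    (πs : Fin N → Measure Ω) [∀ i, IsProbabilityMeasure (πs i)] {i j : Fin N} (hij : i ≠ j) :
    MeasurePreserving (fun ξ : Fin N → Ω => (ξ i, ξ j)) (Measure.pi πs)
      ((πs i).prod (πs j)) := by
  refine ⟨by fun_prop, ?_⟩
  have hind : ProbabilityTheory.iIndepFun (fun (i : Fin N) (ξ : Fin N → Ω) => ξ i)
      (Measure.pi πs) := ProbabilityTheory.iIndepFun_pi (X := fun _ => id) fun i => aemeasurable_id
  have h := (ProbabilityTheory.indepFun_iff_map_prod_eq_prod_map_map
    (measurable_pi_apply i).aemeasurable (measurable_pi_apply j).aemeasurable).1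
    (hind.indepFun hij)
  rw [h, (measurePreserving_eval πs i).map_eq, (measurePreserving_eval πs j).map_eq]

/-- The distance is a Lipschitz function of the finite data of the sample, so it suffices that these
data are a.e. strongly measurable. -/
lemma aemeasurable_samplingDist {D : Type*} [NormedAddCommGroup D] {Ω : Type u}
    [MeasurableSpace Ω] (π : Measure Ω) [IsProbabilityMeasure π] {X : Ω → D} {w : Ω → Ω → ℝ}
    (hX : AEStronglyMeasurable X π)
    (hw : Integrable (fun p : Ω × Ω => w p.1 p.2) (π.prod π))
    (hdiag : AEStronglyMeasurable (fun ξ => w ξ ξ) π) {N : ℕ} [NeZero N]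
    {πs : Fin N → Measure Ω} (hπ : IsIndependentMixture π πs) :
    AEMeasurable (fun ξ : Fin N → Ω => samplingDist X w π ξ) (Measure.pi πs) := by
  have := hπ.isProbabilityMeasure
  have hcont : Continuous fun y : (Fin N → D) × (Fin N → Fin N → ℝ) =>
      unlabeledDist y.1 y.2 (uniformLabel N) X w π :=
    continuous_of_le_add_edist 2 (by simp) (unlabeledDist_le_add_edist π hX hw)
  have hstates : AEStronglyMeasurable (fun (ξ : Fin N → Ω) i => X (ξ i)) (Measure.pi πs) :=
    aestronglyMeasurable_pi_of_eval fun i =>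
      (hX.mono_ac (hπ.absolutelyContinuous i)).comp_measurePreserving (measurePreserving_eval πs i)
  have hweights : AEStronglyMeasurable (fun (ξ : Fin N → Ω) i j => w (ξ i) (ξ j))
      (Measure.pi πs) := by
    refine aestronglyMeasurable_pi_of_eval fun i => aestronglyMeasurable_pi_of_eval fun j => ?_
    -- For `i ≠ j` the pair has law `πs i ⊗ πs j ≪ π ⊗ π`. For `i = j` its law is carried by the
    -- diagonal, where a.e. statements for `π ⊗ π` give no control in general; hence the separate
    -- hypothesis there.
    by_cases hij : i = j
    · subst hij
      exact (hdiag.mono_ac (hπ.absolutelyContinuous i)).comp_measurePreserving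
        (measurePreserving_eval πs i)
    · exact (hw.aestronglyMeasurable.mono_ac ((hπ.absolutelyContinuous i).prod
        (hπ.absolutelyContinuous j))).comp_measurePreserving (measurePreserving_eval_pair πs hij)
  exact (hcont.comp_aestronglyMeasurable (hstates.prodMk hweights)).aemeasurable

end Measurability

/-! ### Expectations over an independent mixture. -/

section Mixture

variable {Ω : Type*} [MeasurableSpace Ω] {π : Measure Ω} {N : ℕ} {πs : Fin N → Measure Ω}

lemma IsIndependentMixture.sum_lintegral (hπ : IsIndependentMixture π πs) (h : Ω → ℝ≥0∞) :
    (N : ℝ≥0∞)⁻¹ * ∑ i, ∫⁻ x, h x ∂(πs i) = ∫⁻ x, h x ∂π := by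
  conv_rhs => rw [← hπ.average]
  rw [lintegral_smul_measure, lintegral_finsetSum_measure, smul_eq_mul]

lemma IsIndependentMixture.aemeasurable_eval (hπ : IsIndependentMixture π πs) {h : Ω → ℝ≥0∞}
    (hh : AEMeasurable h π) (i : Fin N) :
    AEMeasurable (fun ξ : Fin N → Ω => h (ξ i)) (Measure.pi πs) := by
  have := hπ.isProbabilityMeasure
  exact (hh.mono_ac (hπ.absolutelyContinuous i)).comp_quasiMeasurePreserving
    (measurePreserving_eval πs i).quasiMeasurePreserving

lemma IsIndependentMixture.aemeasurable_pair [SFinite π] (hπ : IsIndependentMixture π πs)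
    {h : Ω → Ω → ℝ≥0∞} (hh : AEMeasurable (fun p : Ω × Ω => h p.1 p.2) (π.prod π))
    (hd : AEMeasurable (fun x => h x x) π) (i j : Fin N) :
    AEMeasurable (fun ξ : Fin N → Ω => h (ξ i) (ξ j)) (Measure.pi πs) := by
  have := hπ.isProbabilityMeasure
  by_cases hij : i = j
  · subst hij
    exact hπ.aemeasurable_eval hd i
  · exact (hh.mono_ac ((hπ.absolutelyContinuous i).prod
      (hπ.absolutelyContinuous j))).comp_quasiMeasurePreserving
      (measurePreserving_eval_pair πs hij).quasiMeasurePreserving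

lemma IsIndependentMixture.lintegral_sample (hπ : IsIndependentMixture π πs) {h : Ω → ℝ≥0∞}
    (hh : AEMeasurable h π) :
    ∫⁻ ξ, (N : ℝ≥0∞)⁻¹ * ∑ i, h (ξ i) ∂(Measure.pi πs) = ∫⁻ x, h x ∂π := by
  have := hπ.isProbabilityMeasure
  have hm : ∀ i, AEMeasurable h (πs i) := fun i => hh.mono_ac (hπ.absolutelyContinuous i)
  have hm' := fun i => hπ.aemeasurable_eval hh i
  rw [lintegral_const_mul'' _ (Finset.aemeasurable_fun_sum _ fun i _ => hm' i),
    lintegral_finsetSum' _ fun i _ => hm' i, ← hπ.sum_lintegral]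
  congr 1
  exact Finset.sum_congr rfl fun i _ => (measurePreserving_eval πs i).lintegral_comp_ae (hm i)

lemma IsIndependentMixture.sum_lintegral_prod [SFinite π] (hπ : IsIndependentMixture π πs)
    {h : Ω × Ω → ℝ≥0∞} (hh : AEMeasurable h (π.prod π)) :
    (N : ℝ≥0∞)⁻¹ * ∑ i, (N : ℝ≥0∞)⁻¹ * ∑ j, ∫⁻ p, h p ∂((πs i).prod (πs j)) =
      ∫⁻ p, h p ∂(π.prod π) := by
  have := hπ.isProbabilityMeasure
  have e1 : ∀ i, (N : ℝ≥0∞)⁻¹ * ∑ j, ∫⁻ p, h p ∂((πs i).prod (πs j)) =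
      ∫⁻ x, ∫⁻ y, h (x, y) ∂π ∂(πs i) := by
    intro i
    have hj : ∀ j, AEMeasurable h ((πs i).prod (πs j)) := fun j =>
      hh.mono_ac ((hπ.absolutelyContinuous i).prod (hπ.absolutelyContinuous j))
    have : ∀ j, ∫⁻ p, h p ∂((πs i).prod (πs j)) = ∫⁻ x, ∫⁻ y, h (x, y) ∂(πs j) ∂(πs i) :=
      fun j => lintegral_prod _ (hj j)
    simp_rw [this]
    have hm : ∀ j, AEMeasurable (fun x => ∫⁻ y, h (x, y) ∂(πs j)) (πs i) := fun j =>
      (hj j).lintegral_prod_right'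
    rw [← lintegral_finsetSum' _ fun j _ => hm j,
      ← lintegral_const_mul'' _ (Finset.aemeasurable_fun_sum _ fun j _ => hm j)]
    exact lintegral_congr fun x => hπ.sum_lintegral _
  simp_rw [e1]
  rw [hπ.sum_lintegral, lintegral_prod _ hh]

/-- Pairs `i ≠ j` are independent. The `N` diagonal pairs contribute at most `c / N`; adding the
missing terms for `πs i ⊗ πs i` completes the average over all pairs, which is `π ⊗ π`. -/
lemma IsIndependentMixture.lintegral_sample_pair_le [NeZero N] [SFinite π]
    (hπ : IsIndependentMixture π πs) {h : Ω → Ω → ℝ≥0∞}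
    (hh : AEMeasurable (fun p : Ω × Ω => h p.1 p.2) (π.prod π))
    (hd : AEMeasurable (fun x => h x x) π) {c : ℝ≥0∞} (hc : ∀ᵐ x ∂π, h x x ≤ c) :
    ∫⁻ ξ, (N : ℝ≥0∞)⁻¹ * ∑ i, (N : ℝ≥0∞)⁻¹ * ∑ j, h (ξ i) (ξ j) ∂(Measure.pi πs) ≤
      ∫⁻ p, h p.1 p.2 ∂(π.prod π) + (N : ℝ≥0∞)⁻¹ * c := by
  have := hπ.isProbabilityMeasure
  have hm := fun i j => hπ.aemeasurable_pair hh hd i j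
  have hle : ∀ i j, ∫⁻ ξ, h (ξ i) (ξ j) ∂(Measure.pi πs) ≤
      ∫⁻ p, h p.1 p.2 ∂((πs i).prod (πs j)) + if i = j then c else 0 := by
    intro i j
    by_cases hij : i = j
    · subst hij
      refine le_add_left ?_
      rw [if_pos rfl]
      refine ((measurePreserving_eval πs i).lintegral_comp_ae (f := fun x => h x x)
        (hd.mono_ac (hπ.absolutelyContinuous i))).trans_le ?_
      calc _ ≤ ∫⁻ _, c ∂(πs i) := lintegral_mono_ae ((hπ.absolutelyContinuous i).ae_le hc)
        _ = c := by simp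
    · refine le_add_right (le_of_eq ?_)
      exact (measurePreserving_eval_pair πs hij).lintegral_comp_ae
        (f := fun p : Ω × Ω => h p.1 p.2)
        (hh.mono_ac ((hπ.absolutelyContinuous i).prod (hπ.absolutelyContinuous j)))
  have hN : (N : ℝ≥0∞)⁻¹ * N = 1 :=
    ENNReal.inv_mul_cancel (by simp [NeZero.ne N]) (by simp)
  calc _ = (N : ℝ≥0∞)⁻¹ * ∑ i, (N : ℝ≥0∞)⁻¹ * ∑ j, ∫⁻ ξ, h (ξ i) (ξ j) ∂(Measure.pi πs) := by
        rw [lintegral_const_mul'' _ (Finset.aemeasurable_fun_sum _ fun i _ =>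
          (Finset.aemeasurable_fun_sum _ fun j _ => hm i j).const_mul _),
          lintegral_finsetSum' _ fun i _ =>
            (Finset.aemeasurable_fun_sum _ fun j _ => hm i j).const_mul _]
        congr 1
        refine Finset.sum_congr rfl fun i _ => ?_
        rw [lintegral_const_mul'' _ (Finset.aemeasurable_fun_sum _ fun j _ => hm i j),
          lintegral_finsetSum' _ fun j _ => hm i j]
    _ ≤ (N : ℝ≥0∞)⁻¹ * ∑ i, (N : ℝ≥0∞)⁻¹ * ∑ j,
          (∫⁻ p, h p.1 p.2 ∂((πs i).prod (πs j)) + if i = j then c else 0) := by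
        gcongr with i _ j _
        exact hle i j
    _ = _ := by
        simp_rw [Finset.sum_add_distrib, mul_add, Finset.sum_add_distrib, mul_add]
        rw [hπ.sum_lintegral_prod hh]
        simp only [Finset.sum_ite_eq, Finset.mem_univ, if_true, Finset.sum_const,
          Finset.card_univ, Fintype.card_fin, nsmul_eq_mul]
        rw [← mul_assoc, hN, one_mul]

/-- The expectation of a function of finitely many classes of the sample is a finite sum. -/
lemma lintegral_pi_comp (πs : Fin N → Measure Ω) [∀ i, IsProbabilityMeasure (πs i)]
    {α : Type*} [Fintype α] [MeasurableSpace α] [DiscreteMeasurableSpace α] {f : Ω → α}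
    (hf : Measurable f) {Φ : (Fin N → α) → ℝ} (hΦ : ∀ a, 0 ≤ Φ a) :
    ∫⁻ ξ, ENNReal.ofReal (Φ fun i => f (ξ i)) ∂(Measure.pi πs) =
      ENNReal.ofReal (prodExp (fun i a => (πs i).real (f ⁻¹' {a})) Φ) := by
  have hm : Measurable fun (ξ : Fin N → Ω) i => f (ξ i) := by fun_prop
  rw [← lintegral_map (f := fun a => ENNReal.ofReal (Φ a)) (by fun_prop) hm,
    lintegral_fintype, prodExp, ENNReal.ofReal_sum_of_nonneg fun a _ =>
      mul_nonneg (Finset.prod_nonneg fun i _ => measureReal_nonneg) (hΦ a)]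
  refine Finset.sum_congr rfl fun a _ => ?_
  rw [mul_comm, ENNReal.ofReal_mul (Finset.prod_nonneg fun i _ => measureReal_nonneg),
    Measure.map_apply hm (measurableSet_singleton a)]
  congr 1
  have : (fun (ξ : Fin N → Ω) i => f (ξ i)) ⁻¹' {a} = Set.univ.pi fun i => f ⁻¹' {a i} := by
    ext ξ; simp [funext_iff]
  rw [this, Measure.pi_pi, ENNReal.ofReal_prod_of_nonneg fun i _ => measureReal_nonneg]
  exact Finset.prod_congr rfl fun i _ => by rw [ofReal_measureReal]

end Mixture

/-! ### Approximation of kernels by finite matrices. -/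

section Approximation

variable {Ω : Type*} [MeasurableSpace Ω]

/-- A kernel that is a limit in `L¹` of kernels factoring through finitely many measurable
classes. -/
def IsFinitelyApproximable (π : Measure Ω) (h : Ω × Ω → ℝ) : Prop :=
  ∀ δ : ℝ≥0∞, δ ≠ 0 → ∃ (α : Type) (_ : Fintype α) (_ : MeasurableSpace α)
    (_ : DiscreteMeasurableSpace α) (f : Ω → α) (W : α → α → ℝ), Measurable f ∧
    ∫⁻ p, ‖h p - W (f p.1) (f p.2)‖ₑ ∂(π.prod π) ≤ δ

variable {π : Measure Ω}

lemma IsFinitelyApproximable.of_factor {α : Type} [Fintype α] [MeasurableSpace α]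
    [DiscreteMeasurableSpace α] {f : Ω → α} (hf : Measurable f) (W : α → α → ℝ) :
    IsFinitelyApproximable π fun p => W (f p.1) (f p.2) :=
  fun _ _ => ⟨α, inferInstance, inferInstance, inferInstance, f, W, hf, by simp⟩

lemma IsFinitelyApproximable.of_limit {h : Ω × Ω → ℝ}
    (H : ∀ δ : ℝ≥0∞, δ ≠ 0 → ∃ h', IsFinitelyApproximable π h' ∧
      AEStronglyMeasurable (fun p => h p - h' p) (π.prod π) ∧
      ∫⁻ p, ‖h p - h' p‖ₑ ∂(π.prod π) ≤ δ) : IsFinitelyApproximable π h := by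
  intro δ hδ
  have hδ2 : δ / 2 ≠ 0 := by simp [hδ]
  obtain ⟨h', hh', hm, hle⟩ := H (δ / 2) hδ2
  obtain ⟨α, i1, i2, i3, f, W, hf, hW⟩ := hh' (δ / 2) hδ2
  refine ⟨α, i1, i2, i3, f, W, hf, ?_⟩
  have e : ∀ p, h p - W (f p.1) (f p.2) = (h p - h' p) + (h' p - W (f p.1) (f p.2)) :=
    fun p => by ring
  simp_rw [e]
  exact (lintegral_enorm_add_le hm).trans ((add_le_add hle hW).trans_eq (ENNReal.add_halves δ))

lemma IsFinitelyApproximable.congr_ae {h h' : Ω × Ω → ℝ} (hh : IsFinitelyApproximable π h)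
    (e : h =ᵐ[π.prod π] h') : IsFinitelyApproximable π h' := by
  intro δ hδ
  obtain ⟨α, i1, i2, i3, f, W, hf, hW⟩ := hh δ hδ
  refine ⟨α, i1, i2, i3, f, W, hf, (lintegral_congr_ae ?_).trans_le hW⟩
  filter_upwards [e] with p hp
  rw [hp]

lemma IsFinitelyApproximable.add {h h' : Ω × Ω → ℝ} (hh : IsFinitelyApproximable π h)
    (hh' : IsFinitelyApproximable π h') (hm : AEStronglyMeasurable h (π.prod π)) :
    IsFinitelyApproximable π fun p => h p + h' p := by
  intro δ hδ
  have hδ2 : δ / 2 ≠ 0 := by simp [hδ]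
  obtain ⟨α, i1, i2, i3, f, W, hf, hW⟩ := hh (δ / 2) hδ2
  obtain ⟨α', i1', i2', i3', f', W', hf', hW'⟩ := hh' (δ / 2) hδ2
  refine ⟨α × α', inferInstance, inferInstance, inferInstance, fun x => (f x, f' x),
    fun a b => W a.1 b.1 + W' a.2 b.2, hf.prodMk hf', ?_⟩
  have e : ∀ p : Ω × Ω, h p + h' p - (W (f p.1) (f p.2) + W' (f' p.1) (f' p.2)) =
      (h p - W (f p.1) (f p.2)) + (h' p - W' (f' p.1) (f' p.2)) := fun p => by ring
  simp_rw [e]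
  have hWm : Measurable fun p : Ω × Ω => W (f p.1) (f p.2) :=
    (Measurable.of_discrete (f := fun q : α × α => W q.1 q.2)).comp (hf.prodMap hf)
  exact (lintegral_enorm_add_le (hm.sub hWm.aestronglyMeasurable)).trans
    ((add_le_add hW hW').trans_eq (ENNReal.add_halves δ))

lemma IsFinitelyApproximable.const_mul {h : Ω × Ω → ℝ} (hh : IsFinitelyApproximable π h)
    (c : ℝ) : IsFinitelyApproximable π fun p => c * h p := by
  intro δ hδ
  obtain ⟨α, i1, i2, i3, f, W, hf, hW⟩ := hh (δ / (‖c‖ₑ + 1))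
    (ENNReal.div_ne_zero.2 ⟨hδ, by finiteness⟩)
  refine ⟨α, i1, i2, i3, f, fun a b => c * W a b, hf, ?_⟩
  simp_rw [← mul_sub, enorm_mul]
  rw [lintegral_const_mul' _ _ enorm_ne_top]
  calc _ ≤ (‖c‖ₑ + 1) * (δ / (‖c‖ₑ + 1)) := by gcongr; exact le_self_add
    _ ≤ δ := ENNReal.mul_div_le

/-- Dynkin's theorem from measurable rectangles. For a countable disjoint union, finiteness of the
measure makes the tail small, and only finitely many pieces need approximation. -/
lemma isFinitelyApproximable_indicator [IsFiniteMeasure π] {A : Set (Ω × Ω)}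
    (hA : MeasurableSet A) : IsFinitelyApproximable π (A.indicator fun _ => 1) := by
  induction A, hA using MeasurableSpace.induction_on_inter generateFrom_prod.symm
    isPiSystem_prod with
  | empty =>
    have := IsFinitelyApproximable.of_factor (π := π) (f := fun _ : Ω => ()) (by fun_prop)
      (fun _ _ => 0)
    simpa using this
  | basic t ht =>
    obtain ⟨S, hS, T, hT, rfl⟩ := ht
    classical
    -- Both variables must use the same class map, so it records membership in `S` and in `T`.
    have hf : Measurable fun x => (decide (x ∈ S), decide (x ∈ T)) :=
      (measurable_to_bool (by simpa [Set.preimage] using hS)).prodMk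
        (measurable_to_bool (by simpa [Set.preimage] using hT))
    have := IsFinitelyApproximable.of_factor (π := π) hf
      (fun a b => if a.1 = true ∧ b.2 = true then (1 : ℝ) else 0)
    refine this.congr_ae (Filter.EventuallyEq.of_eq ?_)
    ext p
    simp [Set.indicator, Set.mem_prod]
  | compl t htm ih =>
    have h1 := IsFinitelyApproximable.of_factor (π := π) (f := fun _ : Ω => ()) (by fun_prop)
      (fun _ _ => 1)
    have := h1.add (ih.const_mul (-1)) aestronglyMeasurable_const
    refine this.congr_ae (Filter.EventuallyEq.of_eq ?_)
    ext p
    by_cases hp : p ∈ t <;> simp [hp]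
  | iUnion A hdisj hAm ih =>
    have hfin : ∀ n, IsFinitelyApproximable π ((⋃ i < n, A i).indicator fun _ => 1) := by
      intro n
      induction n with
      | zero =>
        have := IsFinitelyApproximable.of_factor (π := π) (f := fun _ : Ω => ())
          (by fun_prop) (fun _ _ => 0)
        simpa using this
      | succ n ihn =>
        have hmeas : MeasurableSet (⋃ i < n, A i) :=
          MeasurableSet.biUnion (Set.to_countable _) fun i _ => hAm i
        have := ihn.add (ih n)
          ((measurable_const.indicator hmeas).aestronglyMeasurable)
        refine this.congr_ae (Filter.EventuallyEq.of_eq ?_)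
        have hd : Disjoint (⋃ i < n, A i) (A n) := by
          simp only [Set.disjoint_iUnion_left]
          exact fun i hi => hdisj hi.ne
        rw [Set.biUnion_lt_succ, Set.indicator_union_of_disjoint hd]
    refine IsFinitelyApproximable.of_limit fun δ hδ => ?_
    have htend := tendsto_measure_biUnion_Ici_zero_of_pairwise_disjoint (μ := π.prod π)
      (fun i => (hAm i).nullMeasurableSet) hdisj
    obtain ⟨n, hn⟩ := (htend.eventually (Iio_mem_nhds (pos_iff_ne_zero.2 hδ))).exists
    have hmeas : MeasurableSet (⋃ i < n, A i) :=
      MeasurableSet.biUnion (Set.to_countable _) fun i _ => hAm i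
    have htail : MeasurableSet (⋃ i ≥ n, A i) :=
      MeasurableSet.biUnion (Set.to_countable _) fun i _ => hAm i
    refine ⟨_, hfin n, (((measurable_const.indicator (MeasurableSet.iUnion hAm)).sub
      (measurable_const.indicator hmeas)).aestronglyMeasurable), ?_⟩
    calc _ ≤ ∫⁻ p, (⋃ i ≥ n, A i).indicator (fun _ => 1) p ∂(π.prod π) := by
          refine lintegral_mono fun p => ?_
          by_cases hp : p ∈ ⋃ i ≥ n, A i
          · rw [Set.indicator_of_mem hp]
            by_cases h1 : p ∈ ⋃ i, A i <;> by_cases h2 : p ∈ ⋃ i < n, A i <;>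
              simp only [Set.indicator_of_mem, Set.indicator_of_notMem, h1, h2,
                not_false_eq_true] <;> simp
          · rw [Set.indicator_of_notMem hp]
            have : p ∈ (⋃ i, A i) ↔ p ∈ ⋃ i < n, A i := by
              simp only [Set.mem_iUnion, not_exists, exists_prop, ge_iff_le, not_and] at hp ⊢
              refine ⟨fun ⟨i, hi⟩ => ⟨i, ?_, hi⟩, fun ⟨i, _, hi⟩ => ⟨i, hi⟩⟩
              by_contra hlt
              exact hp i (not_lt.1 hlt) hi
            by_cases h1 : p ∈ ⋃ i, A i
            · rw [Set.indicator_of_mem h1, Set.indicator_of_mem (this.1 h1)]; simp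
            · rw [Set.indicator_of_notMem h1, Set.indicator_of_notMem (mt this.2 h1)]; simp
      _ = (π.prod π) (⋃ i ≥ n, A i) := by rw [lintegral_indicator_const htail, one_mul]
      _ ≤ δ := hn.le

lemma isFinitelyApproximable_of_integrable [IsFiniteMeasure π] {h : Ω × Ω → ℝ}
    (hh : Integrable h (π.prod π)) : IsFinitelyApproximable π h := by
  refine Integrable.induction (IsFinitelyApproximable π) (fun c s hs _ => ?_)
    (fun f g _ hf _ h1 h2 => h1.add h2 hf.aestronglyMeasurable) ?_
    (fun f g e _ hf => hf.congr_ae e) hh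
  · refine ((isFinitelyApproximable_indicator hs).const_mul c).congr_ae
      (Filter.EventuallyEq.of_eq ?_)
    ext p
    by_cases hp : p ∈ s <;> simp [hp]
  · refine isClosed_of_closure_subset fun f hf => ?_
    refine IsFinitelyApproximable.of_limit fun δ hδ => ?_
    obtain ⟨g, hg, hlt⟩ := EMetric.mem_closure_iff.1 hf δ (pos_iff_ne_zero.2 hδ)
    refine ⟨g, hg, (Lp.aestronglyMeasurable f).sub (Lp.aestronglyMeasurable g), ?_⟩
    rw [L1.edist_def] at hlt
    simpa only [edist_eq_enorm_sub] using hlt.le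

/-- A bounded kernel is close in `L¹` to a kernel with the same bound that factors through
finitely many measurable classes. -/
lemma exists_finite_kernel_approx [IsFiniteMeasure π] {w : Ω → Ω → ℝ}
    (hw : Integrable (fun p : Ω × Ω => w p.1 p.2) (π.prod π)) {B : ℝ} (hB : 0 ≤ B)
    (hwB : ∀ᵐ p ∂(π.prod π), |w p.1 p.2| ≤ B) {δ : ℝ≥0∞} (hδ : δ ≠ 0) :
    ∃ (α : Type) (_ : Fintype α) (_ : MeasurableSpace α) (_ : DiscreteMeasurableSpace α)
      (f : Ω → α) (W : α → α → ℝ), Measurable f ∧ (∀ a b, |W a b| ≤ B) ∧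
      ∫⁻ p, ‖w p.1 p.2 - W (f p.1) (f p.2)‖ₑ ∂(π.prod π) ≤ δ := by
  obtain ⟨α, i1, i2, i3, f, W, hf, hW⟩ := isFinitelyApproximable_of_integrable hw δ hδ
  -- Clipping to `[-B, B]` is `1`-Lipschitz and fixes `w` almost everywhere, so it does not increase
  -- the error.
  refine ⟨α, i1, i2, i3, f, fun a b => max (-B) (min (W a b) B), hf, fun a b => ?_,
    le_trans ?_ hW⟩
  · exact abs_le.2 ⟨le_max_left _ _, max_le (by linarith) (min_le_right _ _)⟩
  · refine lintegral_mono_ae ?_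
    filter_upwards [hwB] with p hp
    rw [← ofReal_norm, ← ofReal_norm]
    refine ENNReal.ofReal_le_ofReal ?_
    simp only [Real.norm_eq_abs]
    obtain ⟨h1, h2⟩ := abs_le.1 hp
    have e : w p.1 p.2 = max (-B) (min (w p.1 p.2) B) := by
      rw [min_eq_left h2, max_eq_right h1]
    conv_lhs => rw [e]
    refine (abs_max_sub_max_le_max _ _ _ _).trans ?_
    rw [sub_self, abs_zero, max_eq_right (abs_nonneg _)]
    refine (abs_min_sub_min_le_max _ _ _ _).trans ?_
    rw [sub_self, abs_zero, max_eq_left (abs_nonneg _)]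

end Approximation

lemma IsIndependentMixture.measureReal_eq {Ω : Type*} [MeasurableSpace Ω] {π : Measure Ω} {N : ℕ}
    {πs : Fin N → Measure Ω} (hπ : IsIndependentMixture π πs) (s : Set Ω) :
    π.real s = (N : ℝ)⁻¹ * ∑ i, (πs i).real s := by
  have := hπ.isProbabilityMeasure
  conv_lhs => rw [← hπ.average]
  rw [measureReal_def, Measure.smul_apply, Measure.finsetSum_apply, smul_eq_mul,
    ENNReal.toReal_mul, ENNReal.toReal_sum fun i _ => by finiteness]
  simp [measureReal_def]

/-- The expected sampling distance for a state function close in `L¹` to one with finitely many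
values, with the precision `B / √k₀` for the weak regularity lemma. -/
lemma lintegral_samplingDist_le {D : Type*} [NormedAddCommGroup D] {Ω : Type u}
    [MeasurableSpace Ω] [StandardBorelSpace Ω] (π : Measure Ω) [IsProbabilityMeasure π]
    {X : Ω → D} {w : Ω → Ω → ℝ} (hX : AEStronglyMeasurable X π)
    (hw : AEStronglyMeasurable (fun p : Ω × Ω => w p.1 p.2) (π.prod π))
    (hdiag : AEStronglyMeasurable (fun ξ => w ξ ξ) π) {B : ℝ} (hB : 0 < B)
    (hwB : ∀ᵐ p ∂(π.prod π), |w p.1 p.2| ≤ B) (hdB : ∀ᵐ ξ ∂π, |w ξ ξ| ≤ B)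
    {N : ℕ} [NeZero N] {πs : Fin N → Measure Ω} (hπ : IsIndependentMixture π πs)
    {ρ : Type*} [Fintype ρ] [MeasurableSpace ρ] [DiscreteMeasurableSpace ρ] {cls : Ω → ρ}
    (hcls : Measurable cls) (x : ρ → D) {R η : ℝ} (hR0 : 0 ≤ R) (hη : 0 ≤ η)
    (hR : ∀ r, ‖x r‖ ≤ R)
    (hXx : ∫⁻ ζ, ‖X ζ - x (cls ζ)‖ₑ ∂π ≤ ENNReal.ofReal η) {k₀ : ℕ} (hk₀ : 0 < k₀) :
    ∫⁻ ξ, samplingDist X w π ξ ∂(Measure.pi πs) ≤ ENNReal.ofReal (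
      (η + η) + ((B / N + 2 * B / N) + B / N) +
      (4 * (B / √k₀) + 16 * (B / √N) + (B + B * √k₀) / N + B / √k₀) +
      (2 * R + 4 * (B * √k₀)) * (2 * √(Fintype.card ρ * 4 ^ k₀ / N))) := by
  classical
  have := hπ.isProbabilityMeasure
  have hN : (0 : ℝ) < N := by exact_mod_cast NeZero.pos N
  have hwI : Integrable (fun p : Ω × Ω => w p.1 p.2) (π.prod π) :=
    Integrable.of_bound hw B (by simpa only [Real.norm_eq_abs] using hwB)
  obtain ⟨β, _, _, _, fw, W₀, hfw, hW₀, happ⟩ := exists_finite_kernel_approx hwI hB.le hwB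
    (δ := ENNReal.ofReal (B / N)) (by simp only [ne_eq, ENNReal.ofReal_eq_zero, not_le]; positivity)
  -- One finite alphabet carries both the state class and the kernel class, so the expectations of
  -- the sign norm and of the class counts become finite sums.
  set f : Ω → ρ × β := fun ζ => (cls ζ, fw ζ) with hfdef
  have hf : Measurable f := hcls.prodMk hfw
  set W : ρ × β → ρ × β → ℝ := fun a b => W₀ a.2 b.2 with hWdef
  set P : ρ × β → ℝ := fun a => π.real (f ⁻¹' {a}) with hPdef
  set p : Fin N → ρ × β → ℝ := fun i a => (πs i).real (f ⁻¹' {a}) with hpdef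
  have sum_real : ∀ (m : Measure Ω) [IsProbabilityMeasure m], ∑ a, m.real (f ⁻¹' {a}) = 1 := by
    intro m _
    have := measureReal_biUnion_finset (μ := m) (s := Finset.univ) (f := fun a => f ⁻¹' {a})
      (fun a _ b _ hab => Set.disjoint_left.2 fun x (hx : f x = a) (hy : f x = b) =>
        hab (hx.symm.trans hy)) (fun a _ => hf (measurableSet_singleton a))
    rw [← this]
    have : ⋃ a ∈ (Finset.univ : Finset (ρ × β)), f ⁻¹' {a} = Set.univ := by
      ext x; simp
    rw [this]; simp
  have hp0 : ∀ i a, 0 ≤ p i a := fun i a => measureReal_nonneg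
  have hp1 : ∀ i, ∑ a, p i a = 1 := fun i => sum_real (πs i)
  have hPp : ∀ a, P a = (N : ℝ)⁻¹ * ∑ i, p i a := fun a => hπ.measureReal_eq _
  have hP0 : ∀ a, 0 ≤ P a := fun a => measureReal_nonneg
  have hP1 : ∑ a, P a = 1 := sum_real π
  have hk0 : (0 : ℝ) < √k₀ := Real.sqrt_pos.2 (by exact_mod_cast hk₀)
  set ε : ℝ := B / √k₀ with hε
  have hε0 : 0 < ε := div_pos hB hk0
  have hεk : ε * k₀ = B * √k₀ := by
    rw [hε, div_mul_eq_mul_div, div_eq_iff hk0.ne', mul_assoc,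
      Real.mul_self_sqrt (Nat.cast_nonneg _)]
  obtain ⟨k, hk, s, t, hL2, hcut⟩ := exists_sign_rectangles (fun a b => P a * P b)
    (fun a b => mul_nonneg (hP0 a) (hP0 b))
    (by simp_rw [← Finset.mul_sum]; simp [hP1]) W hε0 (fun a b => hW₀ _ _) (k₀ := k₀)
    (by rw [hε, div_pow, Real.sq_sqrt (Nat.cast_nonneg _)]; field_simp; exact le_rfl)
  -- The kernel class `β`, whose size is uncontrolled, is forgotten here. Only the state class and
  -- the `2k` signs that determine `u` are kept, so the number of classes is `card ρ * 4 ^ k`.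
  set g : ρ × β → ρ × (Fin k → ℤˣ) × (Fin k → ℤˣ) :=
    fun a => (a.1, fun l => s l a, fun l => t l a) with hg
  set u : ρ × (Fin k → ℤˣ) × (Fin k → ℤˣ) → ρ × (Fin k → ℤˣ) × (Fin k → ℤˣ) → ℝ :=
    fun c c' => ε * ∑ l, sgn (c.2.1 l) * sgn (c'.2.2 l) with hu
  have huB : ∀ c c', |u c c'| ≤ B * √k₀ := by
    intro c c'
    rw [← hεk, hu, abs_mul, abs_of_pos hε0]
    refine mul_le_mul_of_nonneg_left ((Finset.abs_sum_le_sum_abs _ _).trans ?_) hε0.le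
    simp_rw [abs_mul, abs_sgn]
    simpa using (by exact_mod_cast hk : (k : ℝ) ≤ k₀)
  set Φ₁ : (Fin N → ρ × β) → ℝ := fun a => signNorm fun i j => (N : ℝ)⁻¹ * (N : ℝ)⁻¹ *
    (W (a i) (a j) - u (g (a i)) (g (a j))) with hΦ₁
  set Φ₂ : (Fin N → ρ × β) → ℝ := fun a => (2 * R + 4 * (B * √k₀)) *
    ∑ c, |(∑ i, (N : ℝ)⁻¹ * if g (a i) = c then (1 : ℝ) else 0) -
      π.real ((fun ζ => g (f ζ)) ⁻¹' {c})| with hΦ₂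
  have hcoef : 0 ≤ 2 * R + 4 * (B * √k₀) := by positivity
  have hΦ₁0 : ∀ a, 0 ≤ Φ₁ a := fun a => signNorm_nonneg _
  have hΦ₂0 : ∀ a, 0 ≤ Φ₂ a := fun a =>
    mul_nonneg hcoef (Finset.sum_nonneg fun c _ => abs_nonneg _)
  have hΦm : ∀ Φ : (Fin N → ρ × β) → ℝ,
      Measurable fun ξ : Fin N → Ω => ENNReal.ofReal (Φ fun i => f (ξ i)) := fun Φ =>
    (Measurable.of_discrete (f := fun a => ENNReal.ofReal (Φ a))).comp
      (g := fun a => ENNReal.ofReal (Φ a)) (f := fun (ξ : Fin N → Ω) i => f (ξ i)) (by fun_prop)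
  have hE₁ : prodExp p Φ₁ ≤ 4 * ε + 16 * (B / √N) + (B + B * √k₀) / N := by
    have h := prodExp_signNorm_sample_le hp0 hp1 (fun a b => W a b - u (g a) (g b))
      (M := B + B * √k₀) (fun a => (abs_sub _ _).trans (add_le_add (hW₀ _ _) (huB _ _)))
      (P := P) (by simpa using hPp)
    simp only [Fintype.card_fin] at h
    refine h.trans ?_
    have h2 : √((N : ℝ)⁻¹ * ∑ a, ∑ b, P a * P b * (W a b - u (g a) (g b)) ^ 2) ≤ B / √N := by
      rw [← Real.sqrt_sq hB.le, ← Real.sqrt_div (sq_nonneg B), div_eq_inv_mul]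
      exact Real.sqrt_le_sqrt (mul_le_mul_of_nonneg_left hL2 (by positivity))
    have h3 : (N : ℝ)⁻¹ * (B + B * √k₀) = (B + B * √k₀) / N := by rw [div_eq_inv_mul]
    rw [h3]
    gcongr
  have hE₂ : prodExp p Φ₂ ≤
      (2 * R + 4 * (B * √k₀)) * (2 * √(Fintype.card ρ * 4 ^ k₀ / N)) := by
    rw [hΦ₂, prodExp_const_mul]
    refine mul_le_mul_of_nonneg_left ?_ hcoef
    have hQ : ∀ c, π.real ((fun ζ => g (f ζ)) ⁻¹' {c}) =
        ∑ b, P b * if g b = c then (1 : ℝ) else 0 := by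
      intro c
      have := measureReal_biUnion_finset (μ := π) (s := Finset.univ.filter fun b => g b = c)
        (f := fun a => f ⁻¹' {a})
        (fun a _ b _ hab => Set.disjoint_left.2 fun x (hx : f x = a) (hy : f x = b) =>
          hab (hx.symm.trans hy)) (fun a _ => hf (measurableSet_singleton a))
      simp_rw [mul_ite, mul_one, mul_zero]
      rw [← Finset.sum_filter, ← this]
      congr 1
      ext ζ
      simp
    have hresc : ∀ a : Fin N → ρ × β,
        ∑ c, |(∑ i, (N : ℝ)⁻¹ * if g (a i) = c then (1 : ℝ) else 0) -
          π.real ((fun ζ => g (f ζ)) ⁻¹' {c})| =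
        (N : ℝ)⁻¹ * ∑ c, |(∑ i, if g (a i) = c then (1 : ℝ) else 0) -
          ∑ b, (∑ i, p i b) * if g b = c then (1 : ℝ) else 0| := by
      intro a
      rw [Finset.mul_sum]
      refine Finset.sum_congr rfl fun c _ => ?_
      rw [← abs_of_pos (inv_pos.2 hN), ← abs_mul, abs_of_pos (inv_pos.2 hN), mul_sub, hQ,
        Finset.mul_sum, Finset.mul_sum]
      simp_rw [hPp, mul_assoc]
    simp_rw [hresc]
    rw [prodExp_const_mul]
    refine (mul_le_mul_of_nonneg_left (prodExp_sum_abs_count_sub_le hp0 hp1 g)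
      (by positivity)).trans ?_
    have hcard : (Fintype.card (ρ × (Fin k → ℤˣ) × (Fin k → ℤˣ)) : ℝ) ≤
        Fintype.card ρ * 4 ^ k₀ := by
      simp only [Fintype.card_prod, Fintype.card_fun, Fintype.card_fin, Fintype.card_units_int]
      push_cast
      rw [← mul_pow]
      norm_num
      gcongr
      norm_num
    have hrw : (N : ℝ)⁻¹ * (2 * √((Fintype.card (ρ × (Fin k → ℤˣ) × (Fin k → ℤˣ)) : ℝ) *
        (Fintype.card (Fin N) : ℝ))) =
        2 * √((Fintype.card (ρ × (Fin k → ℤˣ) × (Fin k → ℤˣ)) : ℝ) / N) := by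
      have : (Fintype.card (ρ × (Fin k → ℤˣ) × (Fin k → ℤˣ)) : ℝ) *
          (Fintype.card (Fin N) : ℝ) = (N : ℝ) ^ 2 *
          ((Fintype.card (ρ × (Fin k → ℤˣ) × (Fin k → ℤˣ)) : ℝ) / N) := by
        rw [Fintype.card_fin]; field_simp
      rw [this, Real.sqrt_mul (sq_nonneg _), Real.sqrt_sq hN.le]
      field_simp
    rw [hrw]
    gcongr
  have hxm : AEMeasurable (fun ζ => ‖X ζ - x (g (f ζ)).1‖ₑ) π :=
    (hX.sub ((StronglyMeasurable.of_discrete (f := x)).comp_measurable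
      hcls).aestronglyMeasurable).enorm
  have hWm : Measurable fun q : Ω × Ω => W (f q.1) (f q.2) :=
    (Measurable.of_discrete (f := fun q : (ρ × β) × (ρ × β) => W q.1 q.2)).comp (hf.prodMap hf)
  have hwm : AEMeasurable (fun q : Ω × Ω => ‖w q.1 q.2 - W (f q.1) (f q.2)‖ₑ) (π.prod π) :=
    (hw.sub hWm.aestronglyMeasurable).enorm
  have hwd : AEMeasurable (fun ζ => ‖w ζ ζ - W (f ζ) (f ζ)‖ₑ) π :=
    (hdiag.sub (hWm.comp (measurable_id.prodMk measurable_id)).aestronglyMeasurable).enorm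
  have hT₂m : AEMeasurable (fun ξ : Fin N → Ω => (N : ℝ≥0∞)⁻¹ * ∑ i, (N : ℝ≥0∞)⁻¹ *
      ∑ j, ‖w (ξ i) (ξ j) - W (f (ξ i)) (f (ξ j))‖ₑ) (Measure.pi πs) :=
    (Finset.aemeasurable_fun_sum _ fun i _ => (Finset.aemeasurable_fun_sum _ fun j _ =>
      hπ.aemeasurable_pair (h := fun ζ ζ' => ‖w ζ ζ' - W (f ζ) (f ζ')‖ₑ)
        hwm hwd i j).const_mul _).const_mul _
  have hT₁ := hπ.lintegral_sample hxm
  -- The `L¹` approximation says nothing about the diagonal, where the crude bound `2 B` suffices.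
  have hT₂ := hπ.lintegral_sample_pair_le (h := fun ζ ζ' => ‖w ζ ζ' - W (f ζ) (f ζ')‖ₑ)
    hwm hwd (c := ENNReal.ofReal (2 * B)) (by
      filter_upwards [hdB] with ζ hζ
      rw [← ofReal_norm]
      refine ENNReal.ofReal_le_ofReal ((norm_sub_le _ _).trans ?_)
      rw [Real.norm_eq_abs, Real.norm_eq_abs]
      linarith [hW₀ (f ζ).2 (f ζ).2])
  have hinv : (N : ℝ≥0∞)⁻¹ * ENNReal.ofReal (2 * B) = ENNReal.ofReal (2 * B / N) := by
    rw [div_eq_inv_mul, ENNReal.ofReal_mul (p := (N : ℝ)⁻¹) (by positivity),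
      ENNReal.ofReal_inv_of_pos hN,
      ENNReal.ofReal_natCast]
  rw [hinv] at hT₂
  refine (lintegral_mono fun ξ => samplingDist_le π hX hwI hf g (fun c => x c.1) W u
    (fun c => hR _) huB ξ).trans ?_
  rw [lintegral_add_right _ (hΦm Φ₂), lintegral_add_right _ ((hΦm Φ₁).add_const _),
    lintegral_add_right' _ (hT₂m.add_const _), lintegral_add_right _ measurable_const,
    lintegral_add_right _ measurable_const, lintegral_add_right _ measurable_const,
    lintegral_pi_comp πs hf hΦ₁0, lintegral_pi_comp πs hf hΦ₂0]
  simp only [lintegral_const, measure_univ, mul_one]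
  rw [ENNReal.ofReal_add (by positivity) (by positivity), ENNReal.ofReal_add (by positivity)
    (by positivity), ENNReal.ofReal_add (by positivity) (by positivity),
    ENNReal.ofReal_add hη hη, ENNReal.ofReal_add (p := B / N + 2 * B / N) (by positivity)
    (by positivity), ENNReal.ofReal_add (p := B / N) (by positivity)
    (by positivity), ENNReal.ofReal_add (p := 4 * ε + 16 * (B / √N) + (B + B * √k₀) / N)
    (by positivity) hε0.le]
  refine add_le_add (add_le_add (add_le_add (add_le_add (hT₁.trans_le hXx) hXx)
    (add_le_add (hT₂.trans (add_le_add happ le_rfl)) happ)) (add_le_add ?_ ?_)) ?_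
  · exact ENNReal.ofReal_le_ofReal hE₁
  · exact ENNReal.ofReal_le_ofReal hcut
  · exact ENNReal.ofReal_le_ofReal hE₂

/-! ### Rounding of the states to a finite grid. -/

section Quantizer

/-- The index of the grid point of mesh `1 / n` assigned to `t`, and `0` outside `(-n, n)`. -/
noncomputable def gridIndex (n : ℕ) (t : ℝ) : ℤ := if |t| < n then ⌊t * n⌋ else 0

lemma gridIndex_mem (n : ℕ) (t : ℝ) :
    gridIndex n t ∈ Finset.Icc (-((n : ℤ) ^ 2)) ((n : ℤ) ^ 2) := by
  rw [gridIndex, Finset.mem_Icc]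
  split_ifs with h
  · obtain ⟨h1, h2⟩ := abs_lt.1 h
    have hn : (0 : ℝ) ≤ n := Nat.cast_nonneg n
    constructor
    · rw [Int.le_floor]; push_cast; nlinarith
    · have : (⌊t * n⌋ : ℝ) ≤ (n : ℝ) ^ 2 := (Int.floor_le _).trans (by nlinarith)
      exact_mod_cast this
  · constructor <;> nlinarith [sq_nonneg (n : ℤ)]

lemma measurable_gridIndex (n : ℕ) : Measurable (gridIndex n) :=
  Measurable.ite (measurableSet_lt (by fun_prop) measurable_const)
    (Int.measurable_floor.comp (by fun_prop)) measurable_const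

lemma abs_gridIndex_div_le (n : ℕ) {z : ℤ}
    (hz : z ∈ Finset.Icc (-((n : ℤ) ^ 2)) ((n : ℤ) ^ 2)) : |(z : ℝ) / n| ≤ n := by
  rw [Finset.mem_Icc] at hz
  rcases Nat.eq_zero_or_pos n with rfl | hn
  · simp
  · have hn' : (0 : ℝ) < n := by exact_mod_cast hn
    have h1 : -((n : ℝ) ^ 2) ≤ z := by exact_mod_cast hz.1
    have h2 : (z : ℝ) ≤ (n : ℝ) ^ 2 := by exact_mod_cast hz.2
    rw [abs_div, abs_of_pos hn', div_le_iff₀ hn', ← sq]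
    exact abs_le.2 ⟨h1, h2⟩

/-- Rounding costs at most `1 / n` inside the box; outside, `|t| ≥ n` gives `|t| ≤ t² / n`, so the
second moment controls the truncation. -/
lemma abs_sub_gridIndex_le {n : ℕ} (hn : 0 < n) (t : ℝ) :
    |t - gridIndex n t / n| ≤ 1 / n + t ^ 2 / n := by
  have hn' : (0 : ℝ) < n := by exact_mod_cast hn
  rw [gridIndex]
  split_ifs with h
  · have e : t - (⌊t * n⌋ : ℝ) / n = Int.fract (t * n) / n := by
      rw [← Int.self_sub_floor]; field_simp
    rw [e, abs_of_nonneg (div_nonneg (Int.fract_nonneg _) hn'.le)]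
    have : Int.fract (t * n) / n ≤ 1 / n := by gcongr; exact (Int.fract_lt_one _).le
    have h2 : 0 ≤ t ^ 2 / n := by positivity
    linarith
  · rw [not_lt] at h
    simp only [Int.cast_zero, zero_div, sub_zero]
    have h1 : |t| ≤ t ^ 2 / n := by
      rw [le_div_iff₀ hn', ← sq_abs t, sq]
      exact mul_le_mul_of_nonneg_left h (abs_nonneg t)
    have h2 : (0 : ℝ) ≤ 1 / n := by positivity
    linarith

lemma EuclideanSpace.norm_le_sum_abs {d : ℕ} (y : EuclideanSpace ℝ (Fin d)) :
    ‖y‖ ≤ ∑ i, |y i| := by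
  rw [EuclideanSpace.norm_eq]
  refine Real.sqrt_le_iff.2 ⟨Finset.sum_nonneg fun i _ => abs_nonneg _, ?_⟩
  simp only [Real.norm_eq_abs]
  exact Finset.sum_sq_le_sq_sum_of_nonneg fun i _ => abs_nonneg _

/-- A square-integrable state function in `ℝ^d` is `L¹`-close to one with values in a finite
grid. -/
lemma exists_quantizer (d : ℕ) {Ω : Type*} [MeasurableSpace Ω] (π : Measure Ω)
    [IsProbabilityMeasure π] {X : Ω → EuclideanSpace ℝ (Fin d)} {A : ℝ} (hX : MemLp X 2 π)
    (hA : ∫ ξ, ‖X ξ‖ ^ 2 ∂π ≤ A) {n : ℕ} (hn : 0 < n) :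
    ∃ (cls : Ω → Fin d → Finset.Icc (-((n : ℤ) ^ 2)) ((n : ℤ) ^ 2))
      (x : (Fin d → Finset.Icc (-((n : ℤ) ^ 2)) ((n : ℤ) ^ 2)) → EuclideanSpace ℝ (Fin d)),
      Measurable cls ∧ (∀ r, ‖x r‖ ≤ d * n) ∧
      ∫⁻ ζ, ‖X ζ - x (cls ζ)‖ₑ ∂π ≤ ENNReal.ofReal ((d + A) / n) := by
  have hn' : (0 : ℝ) < n := by exact_mod_cast hn
  -- The class map has to be measurable everywhere, so it is built from a strongly measurable
  -- version of `X`.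
  obtain ⟨X', hX'm, hXX'⟩ := hX.aestronglyMeasurable
  have hcoord : ∀ i, Measurable fun ζ => X' ζ i := fun i =>
    (EuclideanSpace.proj (𝕜 := ℝ) i).continuous.measurable.comp hX'm.measurable
  refine ⟨fun ζ i => ⟨gridIndex n (X' ζ i), gridIndex_mem n _⟩,
    fun r => WithLp.toLp 2 fun i => ((r i : ℤ) : ℝ) / n, ?_, fun r => ?_, ?_⟩
  · exact measurable_pi_lambda _ fun i =>
      ((measurable_gridIndex n).comp (hcoord i)).subtype_mk
  · refine (EuclideanSpace.norm_le_sum_abs _).trans ?_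
    calc _ ≤ ∑ _i : Fin d, (n : ℝ) :=
          Finset.sum_le_sum fun i _ => abs_gridIndex_div_le n (r i).2
      _ = d * n := by simp
  · have hint : Integrable (fun ζ => ‖X ζ‖ ^ 2) π := hX.integrable_norm_pow (by norm_num)
    have hpt : ∀ᵐ ζ ∂π, ‖X ζ - WithLp.toLp 2 fun i => ((gridIndex n (X' ζ i) : ℤ) : ℝ) / n‖ₑ ≤
        ENNReal.ofReal (d / n + ‖X ζ‖ ^ 2 / n) := by
      filter_upwards [hXX'] with ζ hζ
      rw [← hζ, ← ofReal_norm]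
      refine ENNReal.ofReal_le_ofReal ((EuclideanSpace.norm_le_sum_abs _).trans ?_)
      calc _ ≤ ∑ i, (1 / (n : ℝ) + X ζ i ^ 2 / n) :=
            Finset.sum_le_sum fun i _ => abs_sub_gridIndex_le hn (X ζ i)
        _ = _ := by
            rw [Finset.sum_add_distrib, ← Finset.sum_div, EuclideanSpace.norm_sq_eq]
            simp [div_eq_mul_inv, ← Finset.sum_mul]
    refine (lintegral_mono_ae hpt).trans ?_
    have hint' : Integrable (fun ζ => (d : ℝ) / n + ‖X ζ‖ ^ 2 / n) π :=
      (integrable_const _).add (hint.div_const _)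
    rw [← ofReal_integral_eq_lintegral_ofReal hint'
      (Filter.Eventually.of_forall fun ζ => by positivity)]
    refine ENNReal.ofReal_le_ofReal ?_
    rw [integral_add (integrable_const _) (hint.div_const _),
      integral_div (n : ℝ) fun ζ => ‖X ζ‖ ^ 2, add_div]
    simp only [integral_const, probReal_univ, one_smul]
    gcongr

end Quantizer

/-! ### Choice of parameters and the rate. -/

section Rate

lemma exists_one_add_pow_le_exp (m : ℕ) :
    ∃ C : ℝ, 0 < C ∧ ∀ L : ℝ, 0 ≤ L → (1 + L) ^ m ≤ C * Real.exp (3 * L / 8) := by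
  refine ⟨(8 / 3) ^ m * m.factorial * Real.exp (3 / 8), by positivity, fun L hL => ?_⟩
  have h := Real.pow_div_factorial_le_exp (3 / 8 * (1 + L)) (by positivity) m
  rw [div_le_iff₀ (by positivity), mul_pow] at h
  have e : Real.exp (3 / 8 * (1 + L)) = Real.exp (3 / 8) * Real.exp (3 * L / 8) := by
    rw [← Real.exp_add]; ring_nf
  rw [e] at h
  calc (1 + L) ^ m = (8 / 3) ^ m * ((3 / 8) ^ m * (1 + L) ^ m) := by
        rw [← mul_assoc, ← mul_pow]; norm_num
    _ ≤ (8 / 3) ^ m * (Real.exp (3 / 8) * Real.exp (3 * L / 8) * m.factorial) := by gcongr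
    _ = _ := by ring

/-- With `N = exp L`, the number of classes is at most `(5 (1 + L))^d * 4 * exp (L / 4)`, so the
root decays like `exp (-3 L / 8)` up to a polynomial. The exponent `d + 2` collects the grid, the
prefactor of order `1 + L`, and one more factor `1 + L ≥ √L` to reach `1 / √L`. -/
lemma grid_deviation_le (d : ℕ) {B L C₀ : ℝ} {N n k₀ : ℕ} (hB : 0 ≤ B) (hL0 : 0 < L)
    (hexp : Real.exp L = N) (hn2 : (n : ℝ) ≤ √L + 1) (hk2 : (k₀ : ℝ) ≤ L / 8 + 1)
    (hpoly : ∀ L : ℝ, 0 ≤ L → (1 + L) ^ (d + 2) ≤ C₀ * Real.exp (3 * L / 8)) :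
    (2 * (d * n) + 4 * (B * √k₀)) *
        (2 * √((Fintype.card (Fin d → Finset.Icc (-((n : ℤ) ^ 2)) ((n : ℤ) ^ 2)) : ℝ) *
          4 ^ k₀ / N)) ≤ (4 * d + 4 * B) * (4 * 5 ^ d) * C₀ * (1 / √L) := by
  have hs0 : 0 < √L := Real.sqrt_pos.2 hL0
  have hsL : √L ≤ 1 + L := by
    rw [Real.sqrt_le_left (by positivity)]; nlinarith
  have hcard : (Fintype.card (Fin d → Finset.Icc (-((n : ℤ) ^ 2)) ((n : ℤ) ^ 2)) : ℝ) ≤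
      (5 * (1 + L)) ^ d := by
    rw [Fintype.card_fun, Fintype.card_fin, Fintype.card_coe, Int.card_Icc]
    push_cast
    gcongr
    have : ((((n : ℤ) ^ 2 + 1 - -(n : ℤ) ^ 2).toNat : ℤ) : ℝ) = 2 * (n : ℝ) ^ 2 + 1 := by
      rw [Int.toNat_of_nonneg (by nlinarith [sq_nonneg (n : ℤ)])]
      push_cast; ring
    have h2 : ((((n : ℤ) ^ 2 + 1 - -(n : ℤ) ^ 2).toNat : ℕ) : ℝ) = 2 * (n : ℝ) ^ 2 + 1 := by
      exact_mod_cast this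
    rw [h2]
    have h3 : (n : ℝ) ^ 2 ≤ (√L + 1) ^ 2 := by gcongr
    have h4 : √L ^ 2 = L := Real.sq_sqrt hL0.le
    nlinarith [sq_nonneg (√L - 1)]
  have h4k : (4 : ℝ) ^ k₀ ≤ 4 * Real.exp (L / 4) := by
    have hlog : Real.log 4 ≤ 2 := by
      rw [show (4 : ℝ) = 2 ^ 2 by norm_num, Real.log_pow]
      have := Real.log_two_lt_d9
      push_cast; linarith
    have hlog0 : 0 ≤ Real.log 4 := Real.log_nonneg (by norm_num)
    calc (4 : ℝ) ^ k₀ = Real.exp (Real.log 4 * k₀) := by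
          rw [mul_comm, Real.exp_nat_mul, Real.exp_log (by norm_num)]
      _ ≤ Real.exp (Real.log 4 + L / 4) := by
          apply Real.exp_le_exp.2
          nlinarith
      _ = 4 * Real.exp (L / 4) := by rw [Real.exp_add, Real.exp_log (by norm_num)]
  have hroot : √((Fintype.card (Fin d → Finset.Icc (-((n : ℤ) ^ 2)) ((n : ℤ) ^ 2)) : ℝ) *
        4 ^ k₀ / N) ≤ 2 * (5 * (1 + L)) ^ d * Real.exp (-(3 * L / 8)) := by
    rw [Real.sqrt_le_left (by positivity)]
    -- Since the polynomial factor is at least one, it can be squared under the root, which avoids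
    -- half-integer powers.
    have hone : 1 ≤ (5 * (1 + L)) ^ d := one_le_pow₀ (by linarith)
    calc _ ≤ (5 * (1 + L)) ^ d * (4 * Real.exp (L / 4)) / N := by gcongr
      _ = 4 * (5 * (1 + L)) ^ d * Real.exp (-(3 * L / 4)) := by
          rw [← hexp, div_eq_mul_inv, ← Real.exp_neg]
          rw [show -(3 * L / 4) = L / 4 + -L by ring, Real.exp_add]
          ring
      _ ≤ 4 * ((5 * (1 + L)) ^ d * (5 * (1 + L)) ^ d) * Real.exp (-(3 * L / 4)) := by
          gcongr
          exact le_mul_of_one_le_left (by positivity) hone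
      _ = _ := by
          rw [show -(3 * L / 4) = -(3 * L / 8) + -(3 * L / 8) by ring, Real.exp_add]
          ring
  have hk4 : √(k₀ : ℝ) ≤ 1 + L := by
    rw [Real.sqrt_le_left (by positivity)]; nlinarith
  have hfac : 2 * (d * n) + 4 * (B * √k₀) ≤ (4 * d + 4 * B) * (1 + L) := by
    have h1 : (n : ℝ) ≤ 2 * (1 + L) := by linarith
    have h2 : (d : ℝ) * n ≤ d * (2 * (1 + L)) := by gcongr
    have h3 : B * √k₀ ≤ B * (1 + L) := by gcongr
    linarith
  rw [mul_one_div, le_div_iff₀ hs0]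
  calc _ ≤ (4 * d + 4 * B) * (1 + L) *
        (2 * (2 * (5 * (1 + L)) ^ d * Real.exp (-(3 * L / 8)))) * (1 + L) := by gcongr
    _ = (4 * d + 4 * B) * (4 * 5 ^ d) * ((1 + L) ^ (d + 2) * Real.exp (-(3 * L / 8))) := by
        rw [mul_pow]; ring
    _ ≤ (4 * d + 4 * B) * (4 * 5 ^ d) *
          ((C₀ * Real.exp (3 * L / 8)) * Real.exp (-(3 * L / 8))) := by
        gcongr
        exact hpoly L hL0.le
    _ = _ := by
        rw [mul_assoc C₀, ← Real.exp_add]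
        simp

/-- The choice of the grid and of the precision of the weak regularity lemma. -/
lemma exists_rate (d : ℕ) {A B : ℝ} (hA : 0 ≤ A) (hB : 0 < B) :
    ∃ C : ℝ, 0 < C ∧ ∀ N : ℕ, 2 ≤ N → ∃ n k₀ : ℕ, 0 < n ∧ 0 < k₀ ∧
      ((d + A) / n + (d + A) / n) + ((B / N + 2 * B / N) + B / N) +
      (4 * (B / √k₀) + 16 * (B / √N) + (B + B * √k₀) / N + B / √k₀) +
      (2 * (d * n) + 4 * (B * √k₀)) *
        (2 * √((Fintype.card (Fin d → Finset.Icc (-((n : ℤ) ^ 2)) ((n : ℤ) ^ 2)) : ℝ) *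
          4 ^ k₀ / N)) ≤ C / √(Real.log N) := by
  obtain ⟨C₀, hC₀, hpoly⟩ := exists_one_add_pow_le_exp (d + 2)
  -- `37 = 4 + 12 + 16 + 2 + 3`: the `B / N` terms, `4 B / √k₀`, `16 B / √N`, the diagonal term and
  -- the last `B / √k₀`, with `1 / √k₀ ≤ 3 / √L`.
  refine ⟨2 * (d + A) + 37 * B + (4 * d + 4 * B) * (4 * 5 ^ d) * C₀, by positivity,
    fun N hN => ?_⟩
  have hN2 : (2 : ℝ) ≤ N := by exact_mod_cast hN
  have hN0 : (0 : ℝ) < N := by linarith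
  set L : ℝ := Real.log N with hL
  have hL0 : 0 < L := Real.log_pos (by linarith)
  have hLN : L ≤ N - 1 := Real.log_le_sub_one_of_pos hN0
  have hexp : Real.exp L = N := Real.exp_log hN0
  have hs0 : 0 < √L := Real.sqrt_pos.2 hL0
  have hsL : √L ≤ 1 + L := by
    rw [Real.sqrt_le_left (by positivity)]; nlinarith
  refine ⟨⌈√L⌉₊, ⌈L / 8⌉₊, Nat.ceil_pos.2 hs0, Nat.ceil_pos.2 (by positivity), ?_⟩
  set n : ℕ := ⌈√L⌉₊ with hn
  set k₀ : ℕ := ⌈L / 8⌉₊ with hk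
  have hn1 : √L ≤ n := Nat.le_ceil _
  have hn2 : (n : ℝ) ≤ √L + 1 := (Nat.ceil_lt_add_one hs0.le).le
  have hk1 : L / 8 ≤ k₀ := Nat.le_ceil _
  have hk2 : (k₀ : ℝ) ≤ L / 8 + 1 := (Nat.ceil_lt_add_one (by positivity)).le
  have hk3 : (1 : ℝ) ≤ k₀ := by exact_mod_cast Nat.ceil_pos.2 (by positivity : 0 < L / 8)
  have hn0 : (0 : ℝ) < n := hs0.trans_le hn1
  have hk0 : 0 < √(k₀ : ℝ) := Real.sqrt_pos.2 (by linarith)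
  have hsN : √L ≤ √N := Real.sqrt_le_sqrt (by linarith)
  have hsN1 : 1 ≤ √(N : ℝ) := Real.one_le_sqrt.2 (by linarith)
  have hNN : √(N : ℝ) * √N = N := Real.mul_self_sqrt hN0.le
  have b1 : 1 / (n : ℝ) ≤ 1 / √L := one_div_le_one_div_of_le hs0 hn1
  have b2 : 1 / √(N : ℝ) ≤ 1 / √L := one_div_le_one_div_of_le hs0 hsN
  have b3 : 1 / (N : ℝ) ≤ 1 / √L :=
    (one_div_le_one_div_of_le (by positivity) (by nlinarith)).trans b2
  have b4 : 1 / √(k₀ : ℝ) ≤ 3 / √L := by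
    rw [div_le_div_iff₀ hk0 hs0, one_mul]
    have : (3 : ℝ) = √9 := by
      rw [show (9 : ℝ) = 3 ^ 2 by norm_num, Real.sqrt_sq (by norm_num)]
    rw [this, ← Real.sqrt_mul (by norm_num)]
    exact Real.sqrt_le_sqrt (by linarith)
  have b5 : √(k₀ : ℝ) / N ≤ 1 / √L := by
    refine le_trans ?_ b2
    rw [div_le_div_iff₀ hN0 (by positivity), one_mul]
    calc √(k₀ : ℝ) * √N ≤ √N * √N := by
          refine mul_le_mul_of_nonneg_right (Real.sqrt_le_sqrt ?_) (by positivity)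
          linarith
      _ = N := hNN
  have b6 : (2 * (d * n) + 4 * (B * √k₀)) *
        (2 * √((Fintype.card (Fin d → Finset.Icc (-((n : ℤ) ^ 2)) ((n : ℤ) ^ 2)) : ℝ) *
          4 ^ k₀ / N)) ≤ (4 * d + 4 * B) * (4 * 5 ^ d) * C₀ * (1 / √L) :=
    grid_deviation_le d hB.le hL0 hexp hn2 hk2 hpoly
  have hdA : 0 ≤ (d : ℝ) + A := by positivity
  have c1 : (d + A) / n ≤ (d + A) * (1 / √L) := by
    rw [div_eq_mul_one_div]; gcongr
  have c2 : B / N ≤ B * (1 / √L) := by rw [div_eq_mul_one_div]; gcongr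
  have c3 : B / √k₀ ≤ B * (3 / √L) := by rw [div_eq_mul_one_div]; gcongr
  have c4 : B / √N ≤ B * (1 / √L) := by rw [div_eq_mul_one_div]; gcongr
  have c5 : (B + B * √k₀) / N ≤ B * (1 / √L) + B * (1 / √L) := by
    rw [add_div, mul_div_assoc]
    gcongr
  have c6 : 2 * B / N = 2 * (B / N) := by ring
  have e : (2 * (d + A) + 37 * B + (4 * d + 4 * B) * (4 * 5 ^ d) * C₀) / √L =
      2 * (d + A) * (1 / √L) + 37 * B * (1 / √L) +
        (4 * d + 4 * B) * (4 * 5 ^ d) * C₀ * (1 / √L) := by ring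
  rw [e, c6]
  have e3 : B * (3 / √L) = 3 * (B * (1 / √L)) := by ring
  rw [e3] at c3
  linarith

end Rate

/-- The sampling lemma for states in `ℝ^d`. -/
lemma sampling_euclidean (d : ℕ) (A B : ℝ) :
    ∃ C : ℝ, 0 < C ∧
      ∀ (Ω : Type u) [MeasurableSpace Ω] [StandardBorelSpace Ω]
        (π : Measure Ω) [IsProbabilityMeasure π]
        (X : Ω → EuclideanSpace ℝ (Fin d)) (w : Ω → Ω → ℝ),
        MemLp X 2 π → ∫ ξ, ‖X ξ‖ ^ 2 ∂π ≤ A →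
        AEStronglyMeasurable (fun p : Ω × Ω => w p.1 p.2) (π.prod π) →
        AEStronglyMeasurable (fun ξ => w ξ ξ) π →
        (∀ᵐ p ∂(π.prod π), |w p.1 p.2| ≤ B) → (∀ᵐ ξ ∂π, |w ξ ξ| ≤ B) →
        ∀ (N : ℕ), 2 ≤ N → ∀ πs : Fin N → Measure Ω, IsIndependentMixture π πs →
          ∫⁻ ξ : Fin N → Ω, samplingDist X w π ξ ∂(Measure.pi πs) ≤
            ENNReal.ofReal (C / Real.sqrt (Real.log N)) := by
  -- `A` and `B` are arbitrary reals, while the rate needs `A ≥ 0` and `B > 0`; enlarging them only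
  -- weakens the assumptions on the triplet.
  obtain ⟨C, hC, hrate⟩ := exists_rate d (A := max A 0) (B := max B 1) (le_max_right _ _)
    (lt_of_lt_of_le one_pos (le_max_right _ _))
  refine ⟨C, hC, ?_⟩
  intro Ω _ _ π _ X w hX hA hw hdiag hwB hdB N hN πs hπ
  have : NeZero N := ⟨by omega⟩
  obtain ⟨n, k₀, hn, hk₀, hle⟩ := hrate N hN
  obtain ⟨cls, x, hcls, hR, hXx⟩ := exists_quantizer d π hX (hA.trans (le_max_left A 0)) hn
  refine (lintegral_samplingDist_le π hX.aestronglyMeasurable hw hdiag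
    (lt_of_lt_of_le one_pos (le_max_right B 1))
    (hwB.mono fun p hp => hp.trans (le_max_left _ _))
    (hdB.mono fun p hp => hp.trans (le_max_left _ _)) hπ hcls x (by positivity) (by positivity)
    hR hXx hk₀).trans (ENNReal.ofReal_le_ofReal hle)

/-! ### Reduction of the torus to `ℝ^d`. -/

section Torus

/-- The projection from `ℝ^d` to the flat torus. -/
def torusMk {d : ℕ} (y : EuclideanSpace ℝ (Fin d)) : FlatTorus d :=
  WithLp.toLp 2 fun i => (y i : UnitAddCircle)

/-- The representative in `[0, 1)^d` of a point of the flat torus. -/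
noncomputable def torusLift {d : ℕ} (z : FlatTorus d) : EuclideanSpace ℝ (Fin d) :=
  WithLp.toLp 2 fun i => (AddCircle.equivIco 1 0 (z i) : ℝ)

lemma torusMk_torusLift {d : ℕ} (z : FlatTorus d) : torusMk (torusLift z) = z := by
  ext i
  exact AddCircle.coe_equivIco

lemma norm_torusMk_sub_le {d : ℕ} (y y' : EuclideanSpace ℝ (Fin d)) :
    ‖torusMk y - torusMk y'‖ ≤ ‖y - y'‖ := by
  rw [PiLp.norm_eq_of_L2, PiLp.norm_eq_of_L2]
  refine Real.sqrt_le_sqrt (Finset.sum_le_sum fun i _ => pow_le_pow_left₀ (norm_nonneg _) ?_ 2)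
  exact QuotientAddGroup.norm_mk_le_norm (m := y i - y' i)

lemma norm_torusLift_sq_le {d : ℕ} (z : FlatTorus d) : ‖torusLift z‖ ^ 2 ≤ d := by
  rw [EuclideanSpace.norm_sq_eq]
  calc _ ≤ ∑ _i : Fin d, (1 : ℝ) := by
        refine Finset.sum_le_sum fun i _ => ?_
        have h := (AddCircle.equivIco 1 0 (z i)).2
        rw [Real.norm_eq_abs, sq_abs]
        exact pow_le_one₀ h.1 (h.2.le.trans_eq (zero_add 1))
    _ = d := by simp

/-- The representative in `[0, 1)` jumps at `0` but is Borel in each coordinate, which is enough. -/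
lemma aestronglyMeasurable_torusLift {d : ℕ} {Ω : Type*} [MeasurableSpace Ω] {π : Measure Ω}
    {X : Ω → FlatTorus d} (hX : AEStronglyMeasurable X π) :
    AEStronglyMeasurable (fun ζ => torusLift (X ζ)) π := by
  refine AEMeasurable.aestronglyMeasurable ?_
  have hcoord : ∀ i, AEMeasurable (fun ζ => (AddCircle.equivIco 1 0 (X ζ i) : ℝ)) π := fun i =>
    measurable_subtype_coe.comp_aemeasurable
      ((AddCircle.measurableEquivIco 1 0).measurable.comp_aemeasurable
        ((PiLp.continuous_apply 2 (fun _ : Fin d => UnitAddCircle) i).comp_aestronglyMeasurable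
          hX).aemeasurable)
  exact (PiLp.continuous_toLp 2 (fun _ : Fin d => ℝ)).measurable.comp_aemeasurable
    (aemeasurable_pi_lambda _ hcoord)

end Torus

/-- The sampling distance does not increase under a `1`-Lipschitz map of the states. -/
lemma samplingDist_le_of_lipschitz {D E : Type*} [NormedAddCommGroup D] [NormedAddCommGroup E]
    {Ω : Type u} [MeasurableSpace Ω] {π : Measure Ω} {q : E → D}
    (hq : ∀ y y', ‖q y - q y'‖ ≤ ‖y - y'‖) (X : Ω → E) (w : Ω → Ω → ℝ) {N : ℕ}
    (ξ : Fin N → Ω) :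
    samplingDist (fun ζ => q (X ζ)) w π ξ ≤ samplingDist X w π ξ :=
  iInf_mono fun _ => iInf_mono fun _ => iInf_mono fun _ => iInf_mono fun _ => iInf_mono fun _ =>
    iInf_mono fun _ => iInf_mono fun _ => iInf_mono fun _ => iInf_mono fun _ =>
      add_le_add (eLpNorm_mono fun _ => hq _ _) le_rfl

theorem mainTheorem4 (d : ℕ) (A B : ℝ) :
    (∃ C : ℝ, 0 < C ∧
      ∀ (Ω : Type u) [MeasurableSpace Ω] [StandardBorelSpace Ω]
        (π : Measure Ω) [IsProbabilityMeasure π]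
        (X : Ω → EuclideanSpace ℝ (Fin d)) (w : Ω → Ω → ℝ),
        MemLp X 2 π → ∫ ξ, ‖X ξ‖ ^ 2 ∂π ≤ A →
        AEStronglyMeasurable (fun p : Ω × Ω => w p.1 p.2) (π.prod π) →
        AEStronglyMeasurable (fun ξ => w ξ ξ) π →
        (∀ᵐ p ∂(π.prod π), |w p.1 p.2| ≤ B) → (∀ᵐ ξ ∂π, |w ξ ξ| ≤ B) →
        ∀ (N : ℕ), 2 ≤ N → ∀ πs : Fin N → Measure Ω, IsIndependentMixture π πs →
          AEMeasurable (fun ξ : Fin N → Ω => samplingDist X w π ξ) (Measure.pi πs) ∧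
          ∫⁻ ξ : Fin N → Ω, samplingDist X w π ξ ∂(Measure.pi πs) ≤
            ENNReal.ofReal (C / Real.sqrt (Real.log N))) ∧
    (∃ C : ℝ, 0 < C ∧
      ∀ (Ω : Type u) [MeasurableSpace Ω] [StandardBorelSpace Ω]
        (π : Measure Ω) [IsProbabilityMeasure π]
        (X : Ω → FlatTorus d) (w : Ω → Ω → ℝ),
        MemLp X 2 π → ∫ ξ, ‖X ξ‖ ^ 2 ∂π ≤ A →
        AEStronglyMeasurable (fun p : Ω × Ω => w p.1 p.2) (π.prod π) →
        AEStronglyMeasurable (fun ξ => w ξ ξ) π →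
        (∀ᵐ p ∂(π.prod π), |w p.1 p.2| ≤ B) → (∀ᵐ ξ ∂π, |w ξ ξ| ≤ B) →
        ∀ (N : ℕ), 2 ≤ N → ∀ πs : Fin N → Measure Ω, IsIndependentMixture π πs →
          AEMeasurable (fun ξ : Fin N → Ω => samplingDist X w π ξ) (Measure.pi πs) ∧
          ∫⁻ ξ : Fin N → Ω, samplingDist X w π ξ ∂(Measure.pi πs) ≤
            ENNReal.ofReal (C / Real.sqrt (Real.log N))) := by
  have hint : ∀ {Ω : Type u} [MeasurableSpace Ω] {π : Measure Ω} [IsProbabilityMeasure π]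
      {w : Ω → Ω → ℝ}, AEStronglyMeasurable (fun p : Ω × Ω => w p.1 p.2) (π.prod π) →
      (∀ᵐ p ∂(π.prod π), |w p.1 p.2| ≤ B) →
      Integrable (fun p : Ω × Ω => w p.1 p.2) (π.prod π) := fun hw hwB =>
    Integrable.of_bound hw B (by simpa only [Real.norm_eq_abs] using hwB)
  constructor
  · obtain ⟨C, hC, h⟩ := sampling_euclidean.{u} d A B
    refine ⟨C, hC, ?_⟩
    intro Ω _ _ π _ X w hX hA hw hdiag hwB hdB N hN πs hπ
    have : NeZero N := ⟨by omega⟩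
    exact ⟨aemeasurable_samplingDist π hX.aestronglyMeasurable (hint hw hwB) hdiag hπ,
      h Ω π X w hX hA hw hdiag hwB hdB N hN πs hπ⟩
  -- Lifted states lie in `[0, 1)^d`, so their second moment is at most `d`, whatever `A` is.
  · obtain ⟨C, hC, h⟩ := sampling_euclidean.{u} d d B
    refine ⟨C, hC, ?_⟩
    intro Ω _ _ π _ X w hX _ hw hdiag hwB hdB N hN πs hπ
    have : NeZero N := ⟨by omega⟩
    refine ⟨aemeasurable_samplingDist π hX.aestronglyMeasurable (hint hw hwB) hdiag hπ, ?_⟩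
    have hlift : MemLp (fun ζ => torusLift (X ζ)) 2 π :=
      MemLp.of_bound (aestronglyMeasurable_torusLift hX.aestronglyMeasurable) (√d)
        (Filter.Eventually.of_forall fun ζ => Real.le_sqrt_of_sq_le (norm_torusLift_sq_le _))
    have hle : ∫ ζ, ‖torusLift (X ζ)‖ ^ 2 ∂π ≤ d := by
      refine (integral_mono (hlift.integrable_norm_pow (by norm_num)) (integrable_const _)
        fun ζ => norm_torusLift_sq_le _).trans ?_
      simp
    refine (lintegral_mono fun ξ => ?_).trans
      (h Ω π (fun ζ => torusLift (X ζ)) w hlift hle hw hdiag hwB hdB N hN πs hπ)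
    have hX' : X = fun ζ => torusMk (torusLift (X ζ)) := by
      ext1 ζ; exact (torusMk_torusLift _).symm
    conv_lhs => rw [hX']
    exact samplingDist_le_of_lipschitz norm_torusMk_sub_le (fun ζ => torusLift (X ζ)) w ξ
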